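/- **Setting.** Let $\hat{\mathbb H}^3$ be the metric completion of the universal cover of $\mathbb H^3\setminus\sigma$, where $\sigma\subset\mathbb H^3$ is a geodesic. It has cylindrical coordinates $(r,\zeta,\theta)$, with $r\ge 0$ the distance from the added singular geodesic $\hat\sigma$, $\zeta,\theta\in\mathbb R$, and $ds^2=dr^2+\cosh^2 r\,d\zeta^2+\sinh^2 r\,d\theta^2$. For $z\in\mathbb C$ let $\varphi_z$ be the isometry $(r,\zeta,\theta)\mapsto(r,\zeta+\operatorname{Re}z,\theta+\operatorname{Im}z)$. For $0<\alpha\le 2\pi$, $\lambda>0$, $\tau\in\mathbb R$, the model solid torus is $N=N_{\alpha,\lambda,\tau}=\hat{\mathbb H}^3/\langle\varphi_{i\alpha},\varphi_{\lambda+i\tau}\rangle$, with core geodesic $\Sigma$ the image of $\hat\sigma$; it is nonsingular if $\alpha=2\pi$ and singular if $\alpha<2\pi$. For $x\in N$, $\operatorname{injrad}(x)$ is the supremal $\rho$ such that the open metric $\rho$-ball about $x$ is isometric (as a Riemannian ball, with centre mapped to centre) to a $\rho$-ball in $\mathbb H^3$, except that $\operatorname{injrad}(x)=0$ if $\alpha\ne2\pi$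 and $x\in\Sigma$. Put $N^{\le\epsilon}=\{x\in N:\operatorname{injrad}(x)\le\epsilon/2\}$. The radius $r_{\alpha,\lambda,\tau}(\epsilon)$ of this $\epsilon$-tube is the number $r\ge 0$ such that $\partial N^{\le\epsilon}$ is the set of points of $N$ at distance $r$ from $\Sigma$. For $\ell\ge 0$ and $t\in\mathbb R$, not both zero, the translation radius $\operatorname{trad}_{\ell,t}(\epsilon)$ is the value of $r\geq 0$ such that $\varphi_{\ell+it}$ moves every point $(r,\zeta,\theta)$ of $\hat{\mathbb H}^3$ by distance $\epsilon$ if $\epsilon\ge\ell$, and is $-\infty$ if $\epsilon<\ell$. For $b>0$, $a \bmod b$ denotes the $x\in[-b/2,b/2)$ with $a-x\in b\mathbb Z$. Also $\operatorname{arccosh}x=-\infty$ for $x<1$, and $\mathbb N=\{1,2,3,\dots\}$. **Proposition 3.6.** Let $0<\alpha\le2\pi$, $\lambda>0$, $\tau\in\mathbb R$, and let $\epsilon\in\mathbb R$ be such that $N^{\le\epsilon}\neq\emptyset$, where $N=N_{\alpha,\lambda,\tau}$. Then the radius $r_{\alpha,\lambda,\tau}(\epsilon)$ exists, is unique, and is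 given as follows, where all the maxima are attained. If $\alpha=2\pi$, then $$r_{2\pi,\lambda,\tau}(\epsilon)=\max_{n\in\mathbb N}\operatorname{trad}_{n\lambda,\;n\tau\bmod 2\pi}(\epsilon)=\max_{n\in\mathbb N}\operatorname{arccosh}\sqrt{\frac{\cosh\epsilon-\cos(n\tau)}{\cosh(n\lambda)-\cos(n\tau)}}.$$ If $0<\alpha<2\pi$, then $$r_{\alpha,\lambda,\tau}(\epsilon)=\max\Bigl\{\operatorname{trad}_{0,\alpha}(\epsilon),\ \max_{n\in\mathbb N}\operatorname{trad}_{n\lambda,\;n\tau\bmod\alpha}(\epsilon)\Bigr\},$$ and if moreover $\pi\le\alpha<2\pi$, then $\operatorname{trad}_{0,\alpha}(\epsilon)=\epsilon/2$. -/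

import Mathlib

/-! ### Hyperbolic 3-space in the upper half-space model -/

/-- Hyperbolic 3-space `ℍ³`: the upper half-space of points `(w, h)`, `w ∈ ℂ`, `h > 0`. -/
structure HypThree where
  w : ℂ
  h : ℝ
  h_pos : 0 < h

namespace HypThree

/-- The hyperbolic distance of the upper half-space model,
`cosh d = 1 + (|w - w'|² + (h - h')²) / (2 h h')`. -/
noncomputable instance : Dist HypThree where
  dist p q := Real.arcosh (1 + (‖p.w - q.w‖ ^ 2 + (p.h - q.h) ^ 2) / (2 * p.h * q.h))

/-- The base point `0 ∈ ℍ³`. -/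
def base : HypThree := ⟨0, 1, one_pos⟩

/-- The open ball `B_ρ(0)` about the base point. -/
def baseBall (ρ : ℝ) : Set HypThree := {p | dist p base < ρ}

end HypThree

/-! ### The infinite cyclic branched cover of hyperbolic 3-space along a geodesic -/

/-- Cylindrical coordinates `(r, ζ, θ)`, `r ≥ 0`, with real-valued angle `θ`. Coordinate triples
with `r > 0` parametrize the universal cover of `ℍ³ ∖ σ`; triples with `r = 0` describe the
points added in the completion. -/
structure Cyl where
  r : ℝ
  ζ : ℝ
  θ : ℝ
  r_nonneg : 0 ≤ r

namespace Cyl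

/-- `PathOfLength p q ℓ`: there is a piecewise `C¹` path from `p` to `q` (a concatenation of
finitely many `C¹` paths) whose length for `ds² = dr² + cosh² r dζ² + sinh² r dθ²` is `ℓ`. -/
inductive PathOfLength : Cyl → Cyl → ℝ → Prop
  | smooth (p q : Cyl) (r ζ θ : ℝ → ℝ)
      (hr : ContDiff ℝ 1 r) (hζ : ContDiff ℝ 1 ζ) (hθ : ContDiff ℝ 1 θ)
      (r_nonneg : ∀ t ∈ Set.Icc (0 : ℝ) 1, 0 ≤ r t)
      (start_eq : r 0 = p.r ∧ ζ 0 = p.ζ ∧ θ 0 = p.θ)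
      (end_eq : r 1 = q.r ∧ ζ 1 = q.ζ ∧ θ 1 = q.θ) :
      PathOfLength p q (∫ t in (0 : ℝ)..1, Real.sqrt (deriv r t ^ 2 +
        Real.cosh (r t) ^ 2 * deriv ζ t ^ 2 + Real.sinh (r t) ^ 2 * deriv θ t ^ 2))
  | trans {p q s : Cyl} {a b : ℝ} :
      PathOfLength p q a → PathOfLength q s b → PathOfLength p s (a + b)

theorem PathOfLength.nonneg {p q : Cyl} {a : ℝ} (h : PathOfLength p q a) : 0 ≤ a := by
  induction h with
  | smooth =>
    exact intervalIntegral.integral_nonneg zero_le_one fun t _ => Real.sqrt_nonneg _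
  | trans _ _ h₁ h₂ => exact add_nonneg h₁ h₂

theorem PathOfLength.refl (p : Cyl) : PathOfLength p p 0 := by
  have h := PathOfLength.smooth p p (fun _ => p.r) (fun _ => p.ζ) (fun _ => p.θ)
    contDiff_const contDiff_const contDiff_const (fun _ _ => p.r_nonneg) ⟨rfl, rfl, rfl⟩
    ⟨rfl, rfl, rfl⟩
  simpa using h

theorem PathOfLength.symm {p q : Cyl} {a : ℝ} (h : PathOfLength p q a) : PathOfLength q p a := by
  induction h with
  | smooth p q r ζ θ hr hζ hθ h0 hs he =>
    have hsub : ContDiff ℝ 1 (fun t : ℝ => 1 - t) := contDiff_const.sub contDiff_id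
    have hd : ∀ f : ℝ → ℝ, ∀ t, deriv (fun t => f (1 - t)) t = -deriv f (1 - t) :=
      fun f t => deriv_comp_const_sub (f := f) (a := 1) (x := t)
    have h := PathOfLength.smooth q p (fun t => r (1 - t)) (fun t => ζ (1 - t))
      (fun t => θ (1 - t)) (hr.comp hsub) (hζ.comp hsub) (hθ.comp hsub)
      (fun t ht => h0 _ ⟨by linarith [ht.2], by linarith [ht.1]⟩) (by simpa using he)
      (by simpa using hs)
    simp only [hd, neg_sq] at h
    rw [intervalIntegral.integral_comp_sub_left (fun t => Real.sqrt (deriv r t ^ 2 +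
        Real.cosh (r t) ^ 2 * deriv ζ t ^ 2 + Real.sinh (r t) ^ 2 * deriv θ t ^ 2)) 1] at h
    simpa using h
  | trans _ _ h₁ h₂ => rw [add_comm]; exact h₂.trans h₁

theorem PathOfLength.exists (p q : Cyl) : ∃ a, PathOfLength p q a := by
  have hc : ∀ a b : ℝ, ContDiff ℝ 1 (fun t : ℝ => (1 - t) * a + t * b) := fun a b => by fun_prop
  exact ⟨_, PathOfLength.smooth p q _ _ _ (hc p.r q.r) (hc p.ζ q.ζ) (hc p.θ q.θ)
    (fun t ht => add_nonneg (mul_nonneg (by linarith [ht.2]) p.r_nonneg)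
      (mul_nonneg ht.1 q.r_nonneg)) (by simp) (by simp)⟩

/-- The translation of cylindrical coordinates by the complex length `z`. -/
def shift (z : ℂ) (p : Cyl) : Cyl := ⟨p.r, p.ζ + z.re, p.θ + z.im, p.r_nonneg⟩

theorem PathOfLength.shift (z : ℂ) {p q : Cyl} {a : ℝ} (h : PathOfLength p q a) :
    PathOfLength (p.shift z) (q.shift z) a := by
  induction h with
  | smooth p q r ζ θ hr hζ hθ h0 hs he =>
    have h := PathOfLength.smooth (p.shift z) (q.shift z) r (fun t => ζ t + z.re)
      (fun t => θ t + z.im) hr (hζ.add contDiff_const) (hθ.add contDiff_const) h0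
      (by simpa [Cyl.shift] using hs) (by simpa [Cyl.shift] using he)
    simpa using h
  | trans _ _ h₁ h₂ => exact h₁.trans h₂

theorem bddBelow_lengths (p q : Cyl) : BddBelow {a | PathOfLength p q a} :=
  ⟨0, fun _ h => h.nonneg⟩

/-- The path distance of `ds² = dr² + cosh² r dζ² + sinh² r dθ²`. It is only a pseudo-distance:
two triples with `r = 0` and equal `ζ` have distance zero. -/
noncomputable instance : PseudoMetricSpace Cyl where
  dist p q := sInf {a | PathOfLength p q a}
  dist_self p := le_antisymm (csInf_le (bddBelow_lengths p p) (PathOfLength.refl p))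
    (Real.sInf_nonneg fun _ h => PathOfLength.nonneg h)
  dist_comm p q := congrArg sInf (Set.ext fun _ => ⟨PathOfLength.symm, PathOfLength.symm⟩)
  dist_triangle p q s := by
    refine le_of_forall_pos_le_add fun e he => ?_
    obtain ⟨a, ha, ha'⟩ := exists_lt_of_csInf_lt (PathOfLength.exists p q)
      (lt_add_of_pos_right (sInf {a | PathOfLength p q a}) (half_pos he))
    obtain ⟨b, hb, hb'⟩ := exists_lt_of_csInf_lt (PathOfLength.exists q s)
      (lt_add_of_pos_right (sInf {a | PathOfLength q s a}) (half_pos he))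
    have h := csInf_le (bddBelow_lengths p s) (PathOfLength.trans ha hb)
    linarith

theorem dist_def (p q : Cyl) : dist p q = sInf {a | PathOfLength p q a} := rfl

theorem shift_shift (z w : ℂ) (p : Cyl) : (p.shift w).shift z = p.shift (z + w) := by
  cases p; simp [shift]; constructor <;> ring

theorem shift_zero (p : Cyl) : p.shift 0 = p := by cases p; simp [shift]

theorem isometry_shift (z : ℂ) : Isometry (shift z) := by
  refine Isometry.of_dist_eq fun p q => congrArg sInf (Set.ext fun a => ⟨fun h => ?_, fun h => ?_⟩)
  · simpa [shift_shift, shift_zero] using PathOfLength.shift (-z) h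
  · exact PathOfLength.shift z h

end Cyl

/-- The space `Ĥ³`: the metric space of cylindrical coordinates with the path distance, triples at
distance zero being identified. It is the metric completion of the universal cover of `ℍ³ ∖ σ`. -/
abbrev HHat : Type := SeparationQuotient Cyl

namespace HHat

/-- The point of `Ĥ³` with cylindrical coordinates `(r, ζ, θ)`. -/
noncomputable def pt (r ζ θ : ℝ) (hr : 0 ≤ r) : HHat := SeparationQuotient.mk ⟨r, ζ, θ, hr⟩

/-- The singular geodesic `σ̂` of `Ĥ³`. -/
def axis : Set HHat := {p | ∃ ζ θ : ℝ, p = pt 0 ζ θ le_rfl}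

/-- The action of `ℂ` on `Ĥ³`: `φ_z` translates along `σ̂` by `Re z` and rotates by `Im z`. -/
noncomputable instance : AddAction ℂ HHat where
  vadd z := SeparationQuotient.lift (fun p => SeparationQuotient.mk (p.shift z)) fun _ _ h =>
    SeparationQuotient.mk_eq_mk.2 (h.map (Cyl.isometry_shift z).continuous)
  zero_vadd := by
    rintro ⟨p⟩
    exact congrArg SeparationQuotient.mk p.shift_zero
  add_vadd := by
    rintro z w ⟨p⟩
    exact congrArg SeparationQuotient.mk (Cyl.shift_shift z w p).symm

theorem vadd_pt (z : ℂ) (r ζ θ : ℝ) (hr : 0 ≤ r) :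
    z +ᵥ pt r ζ θ hr = pt r (ζ + z.re) (θ + z.im) hr := rfl

end HHat

/-! ### Model solid tori -/

/-- The group generated by the elliptic `ψ_{iα}` and the loxodromic `φ_{l+iτ}`. -/
def deckGroup (α l τ : ℝ) : AddSubgroup ℂ := AddSubgroup.closure {⟨0, α⟩, ⟨l, τ⟩}

/-- The model solid torus `N_{α,l,τ}`, the quotient of `Ĥ³` by `⟨ψ_{iα}, φ_{l+iτ}⟩`. It carries the
quotient topology. -/
abbrev ModelTorus (α l τ : ℝ) : Type := AddAction.orbitRel.Quotient (deckGroup α l τ) HHat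

namespace ModelTorus

variable {α l τ : ℝ}

/-- The projection `Ĥ³ → N`. -/
noncomputable def proj (p : HHat) : ModelTorus α l τ := Quotient.mk _ p

/-- The quotient distance on `N`: the infimum of the distances between lifts. -/
noncomputable instance : Dist (ModelTorus α l τ) where
  dist x y := sInf {d | ∃ p q : HHat, proj p = x ∧ proj q = y ∧ d = dist p q}

/-- The core geodesic `Σ` of `N`. -/
def core (α l τ : ℝ) : Set (ModelTorus α l τ) := proj '' HHat.axis

/-- The open metric ball of radius `ρ` about `x`. -/
def openBall (x : ModelTorus α l τ) (ρ : ℝ) : Set (ModelTorus α l τ) := {y | dist y x < ρ}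

/-- The open `ρ`-ball about `x` is isometric to the ball `B_ρ(0) ⊂ ℍ³`. Isometry is meant in the
sense of Riemannian geometry (equivalently, for the intrinsic path metrics of the two balls):
a centre-preserving bijection which, like its inverse, preserves distances locally. -/
def BallIsometric (x : ModelTorus α l τ) (ρ : ℝ) : Prop :=
  ∃ f : HypThree → ModelTorus α l τ, f HypThree.base = x ∧
    Set.BijOn f (HypThree.baseBall ρ) (openBall x ρ) ∧
    ∀ p ∈ HypThree.baseBall ρ, ∃ δ > 0,
      ∀ a ∈ HypThree.baseBall ρ, ∀ b ∈ HypThree.baseBall ρ,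
        (dist a p < δ ∧ dist b p < δ) ∨ (dist (f a) (f p) < δ ∧ dist (f b) (f p) < δ) →
          dist (f a) (f b) = dist a b

open Classical in
/-- The injectivity radius of `x ∈ N`, set to `0` on a singular core. -/
noncomputable def injrad (x : ModelTorus α l τ) : ℝ :=
  if α ≠ 2 * Real.pi ∧ x ∈ core α l τ then 0 else sSup {ρ : ℝ | 0 ≤ ρ ∧ BallIsometric x ρ}

/-- The closed thin part `N^{≤ε}`. -/
def thin (α l τ ε : ℝ) : Set (ModelTorus α l τ) := {x | injrad x ≤ ε / 2}

/-- The distance from `x` to the core. -/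
noncomputable def coreDist (x : ModelTorus α l τ) : ℝ :=
  sInf {d | ∃ y ∈ core α l τ, d = dist x y}

/-- The equidistant torus `T_r` at radius `r` about the core. -/
def equidistant (α l τ r : ℝ) : Set (ModelTorus α l τ) := {x | coreDist x = r}

/-- `r` is the radius `r_{α,l,τ}(ε)` of the tube `N^{≤ε}`: the boundary `T^ε = ∂N^{≤ε}` is the
equidistant torus `T_r`. -/
def IsTubeRadius (α l τ ε r : ℝ) : Prop :=
  0 ≤ r ∧ frontier (thin α l τ ε) = equidistant α l τ r

end ModelTorus

/-! ### Translation radii -/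

/-- The translation radius `trad_{l,τ}(ε)`: the value of `r` such that `φ_{l+iτ}` translates all
points of `Ĥ³` of the form `(r, ζ, θ)` by distance `ε`; it is `-∞` if `ε < l`.
(When `ε ≥ l ≥ 0` and `φ_{l+iτ}` is not the identity, there is exactly one such `r`.) -/
noncomputable def trad (l τ ε : ℝ) : EReal :=
  if ε < l then ⊥ else
    sSup {x : EReal | ∃ (r : ℝ) (hr : 0 ≤ r), x = (r : EReal) ∧
      ∀ ζ θ : ℝ, dist (HHat.pt r ζ θ hr) ((⟨l, τ⟩ : ℂ) +ᵥ HHat.pt r ζ θ hr) = ε}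

/-- `a mod b`, the representative of `a` modulo `b` in `[-b/2, b/2)`. -/
noncomputable def angleMod (a b : ℝ) (hb : 0 < b) : ℝ := toIcoMod hb (-(b / 2)) a

/-- `arccosh` with the convention `arccosh x = -∞` for `x < 1`. -/
noncomputable def arccoshBot (x : ℝ) : EReal := if x < 1 then ⊥ else (Real.arcosh x : EReal)

/-! In the branched cover, the distance obeys the hyperbolic law of cosines with the cosine replaced
by `cutCos`, which stays at `-1` beyond `π`: once the angle reaches `π`, a shortest path runs
through the axis (`dist_eq_adist`). For the lower bound, any `k` with `k' ^ 2 + k ^ 2 = 1` makes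
`cosh` of the would-be distance a function `u` whose gradient has squared norm `u ^ 2 - 1`, so the
would-be distance grows along a path by at most its length. For the upper bound, explicit paths come
from segments of the hyperboloid model, broken at the axis when the angle is wide. The choice `k =
cos` gives the distance of `ℍ³`, which is the cover modulo whole turns.

So the torus is always a quotient of one of these law-of-cosines distances by a group `S` of
translations (`IsQuotientModel`): `cutCos` with the whole deck group, or, for `α = 2π`, `cos` with
the cyclic group of the loxodromic generator.

Off a singular core, the injectivity radius is half the shortest displacement `2R`. The ball of
radius `R` embeds by the triangle inequality. If a larger ball were hyperbolic, the loop of length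
`2R` at `x` would pull back to a loop in `ℍ³` whose halves are both shortest paths between the same
two points; they would coincide, although the loop does not fold back at its middle. This fails only
if the shortest segment hits a singular axis, that is, if the shortest element turns by at least
`π`; but then its displacement is at least `2r`, and no hyperbolic ball contains a point of a
singular core, because antipodal points near a cone axis are too close (`ball_disjoint_core`).

Finally, a translation by `z` moves points at radius `r` by `d` with `cosh d = cosh² r (cosh (Re z)
- k (Im z)) + k (Im z)`, which is nondecreasing in `r`. Being moved by at most `ε` thus means `r ≤
trad`, and the thin part is the solid tube whose radius is the largest translation radius. Only
finitely many `n` satisfy `n l ≤ ε`, so the maxima are attained; the boundary of the tube is the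
equidistant set. -/

/-! ### Angle functions and the frozen cosine -/

/-- Functions that can replace the cosine in the hyperbolic law of cosines. -/
structure AngleFun (k : ℝ → ℝ) : Prop where
  deriv : ∀ θ, ∃ s, HasDerivAt k s θ ∧ s ^ 2 + k θ ^ 2 = 1
  zero : k 0 = 1
  even : ∀ θ, k (-θ) = k θ

/-- The cosine, frozen at `-1` once the angle exceeds `π`. -/
noncomputable def cutCos (θ : ℝ) : ℝ := Real.cos (min |θ| Real.pi)

theorem angleFun_cos : AngleFun Real.cos where
  deriv θ := ⟨_, Real.hasDerivAt_cos θ, by rw [neg_sq, Real.sin_sq_add_cos_sq]⟩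
  zero := Real.cos_zero
  even := Real.cos_neg

theorem cutCos_of_le {θ : ℝ} (h : |θ| ≤ Real.pi) : cutCos θ = Real.cos θ := by
  rw [cutCos, min_eq_left h, Real.cos_abs]

theorem cutCos_of_ge {θ : ℝ} (h : Real.pi ≤ |θ|) : cutCos θ = -1 := by
  rw [cutCos, min_eq_right h, Real.cos_pi]

theorem cutCos_neg (θ : ℝ) : cutCos (-θ) = cutCos θ := by rw [cutCos, cutCos, abs_neg]

theorem cutCos_anti {θ φ : ℝ} (h : |θ| ≤ |φ|) : cutCos φ ≤ cutCos θ :=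
  Real.cos_le_cos_of_nonneg_of_le_pi (le_min (abs_nonneg _) Real.pi_pos.le) (min_le_right _ _)
    (min_le_min_right _ h)

theorem cutCos_lt_one {θ : ℝ} (h : θ ≠ 0) : cutCos θ < 1 := by
  have := Real.cos_lt_cos_of_nonneg_of_le_pi le_rfl (min_le_right |θ| Real.pi)
    (lt_min (abs_pos.2 h) Real.pi_pos)
  rwa [Real.cos_zero] at this

/-- The two pieces meet at `π` with equal one-sided derivatives, because `sin π = 0`. The constant
`-1` also satisfies `s ^ 2 + k ^ 2 = 1`, with `s = 0`. -/
theorem hasDerivAt_cutCos_of_pos {θ : ℝ} (h : 0 < θ) :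
    ∃ s, HasDerivAt cutCos s θ ∧ s ^ 2 + cutCos θ ^ 2 = 1 := by
  have hpi := Real.pi_pos
  rcases lt_trichotomy θ Real.pi with h' | h' | h'
  · refine ⟨-Real.sin θ, (Real.hasDerivAt_cos θ).congr_of_eventuallyEq ?_, ?_⟩
    · filter_upwards [Ioo_mem_nhds h h'] with x hx
      exact cutCos_of_le (by rw [abs_of_pos hx.1]; exact hx.2.le)
    · rw [cutCos_of_le (by rw [abs_of_pos h]; exact h'.le), neg_sq, Real.sin_sq_add_cos_sq]
  · refine ⟨0, ?_, by rw [h', cutCos_of_le (by rw [abs_of_pos hpi])]; simp⟩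
    have h1 : HasDerivWithinAt cutCos 0 (Set.Iic θ) θ := by
      have := (Real.hasDerivAt_cos θ).hasDerivWithinAt (s := Set.Iic θ)
      rw [h', Real.sin_pi, neg_zero, ← h'] at this
      refine this.congr_of_eventuallyEq_of_mem ?_ Set.self_mem_Iic
      filter_upwards [mem_nhdsWithin_of_mem_nhds (Ioi_mem_nhds h), self_mem_nhdsWithin] with x hx hx'
      exact cutCos_of_le (by rw [abs_of_pos hx]; exact h' ▸ hx')
    have h2 : HasDerivWithinAt cutCos 0 (Set.Ici θ) θ := by
      refine (hasDerivWithinAt_const θ (Set.Ici θ) (-1 : ℝ)).congr_of_eventuallyEq_of_mem ?_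
        Set.self_mem_Ici
      filter_upwards [self_mem_nhdsWithin] with x hx
      exact cutCos_of_ge (by rw [abs_of_pos (h.trans_le hx)]; exact h' ▸ hx)
    have := h1.union h2
    rwa [Set.Iic_union_Ici, hasDerivWithinAt_univ] at this
  · refine ⟨0, (hasDerivAt_const θ (-1 : ℝ)).congr_of_eventuallyEq ?_, ?_⟩
    · filter_upwards [Ioi_mem_nhds h'] with x hx
      exact cutCos_of_ge (by rw [abs_of_pos (hpi.trans hx)]; exact le_of_lt hx)
    · rw [cutCos_of_ge (by rw [abs_of_pos h]; exact h'.le)]; norm_num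

theorem angleFun_cutCos : AngleFun cutCos where
  deriv θ := by
    rcases lt_trichotomy θ 0 with h | h | h
    · obtain ⟨s, hs, hs'⟩ := hasDerivAt_cutCos_of_pos (neg_pos.2 h)
      refine ⟨-s, ?_, by rwa [neg_sq, ← cutCos_neg]⟩
      have := hs.scomp θ (hasDerivAt_neg θ)
      simp only [smul_eq_mul, neg_one_mul] at this
      exact this.congr_of_eventuallyEq (.of_forall fun x => (cutCos_neg x).symm)
    · refine ⟨-Real.sin θ, (Real.hasDerivAt_cos θ).congr_of_eventuallyEq ?_, ?_⟩
      · filter_upwards [Ioo_mem_nhds (a := -Real.pi) (b := Real.pi) (x := θ)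
          (by rw [h]; linarith [Real.pi_pos]) (by rw [h]; exact Real.pi_pos)] with x hx
        exact cutCos_of_le (abs_le.2 ⟨hx.1.le, hx.2.le⟩)
      · rw [cutCos_of_le (by rw [h, abs_zero]; exact Real.pi_pos.le), neg_sq,
          Real.sin_sq_add_cos_sq]
    · exact hasDerivAt_cutCos_of_pos h
  zero := by rw [cutCos_of_le (by rw [abs_zero]; exact Real.pi_pos.le), Real.cos_zero]
  even := cutCos_neg

theorem AngleFun.sq_le {k : ℝ → ℝ} (hk : AngleFun k) (θ : ℝ) : k θ ^ 2 ≤ 1 := by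
  obtain ⟨s, -, hs⟩ := hk.deriv θ
  nlinarith [sq_nonneg s]

theorem AngleFun.le_one {k : ℝ → ℝ} (hk : AngleFun k) (θ : ℝ) : k θ ≤ 1 :=
  (abs_le_one_iff_mul_self_le_one.2 (by nlinarith [hk.sq_le θ]) |> abs_le.1).2

theorem AngleFun.neg_one_le {k : ℝ → ℝ} (hk : AngleFun k) (θ : ℝ) : -1 ≤ k θ :=
  (abs_le_one_iff_mul_self_le_one.2 (by nlinarith [hk.sq_le θ]) |> abs_le.1).1

/-! ### Law-of-cosines distances bound path lengths from below -/

namespace Cyl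

/-- The hyperbolic cosine of the distance, computed with the angle function `k`. -/
noncomputable def chd (k : ℝ → ℝ) (p q : Cyl) : ℝ :=
  Real.cosh p.r * Real.cosh q.r * Real.cosh (p.ζ - q.ζ) -
    Real.sinh p.r * Real.sinh q.r * k (p.θ - q.θ)

/-- The distance given by the hyperbolic law of cosines with the angle function `k`. -/
noncomputable def adist (k : ℝ → ℝ) (p q : Cyl) : ℝ := Real.arcosh (chd k p q)

variable {k : ℝ → ℝ}

theorem sinh_r_nonneg (p : Cyl) : 0 ≤ Real.sinh p.r := Real.sinh_nonneg_iff.2 p.r_nonneg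

theorem cosh_sub_le_chd (hk : AngleFun k) (p q : Cyl) : Real.cosh (p.r - q.r) ≤ chd k p q := by
  have h1 := Real.one_le_cosh (p.ζ - q.ζ)
  have h2 := hk.le_one (p.θ - q.θ)
  have h3 := mul_pos (Real.cosh_pos p.r) (Real.cosh_pos q.r)
  have h4 := mul_nonneg p.sinh_r_nonneg q.sinh_r_nonneg
  rw [Real.cosh_sub, chd]
  nlinarith [mul_nonneg h3.le (sub_nonneg.2 h1), mul_nonneg h4 (sub_nonneg.2 h2)]

theorem one_le_chd (hk : AngleFun k) (p q : Cyl) : 1 ≤ chd k p q :=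
  (Real.one_le_cosh _).trans (cosh_sub_le_chd hk p q)

theorem cosh_adist (hk : AngleFun k) (p q : Cyl) : Real.cosh (adist k p q) = chd k p q :=
  Real.cosh_arcosh (one_le_chd hk p q)

theorem adist_nonneg (hk : AngleFun k) (p q : Cyl) : 0 ≤ adist k p q :=
  Real.arcosh_nonneg (one_le_chd hk p q)

theorem chd_self (hk : AngleFun k) (p : Cyl) : chd k p p = 1 := by
  simp only [chd, sub_self, hk.zero, Real.cosh_zero]
  nlinarith [Real.cosh_sq p.r]

theorem adist_self (hk : AngleFun k) (p : Cyl) : adist k p p = 0 := by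
  rw [adist, chd_self hk, Real.arcosh_zero]

theorem chd_comm (hk : AngleFun k) (p q : Cyl) : chd k p q = chd k q p := by
  rw [chd, chd, ← neg_sub q.ζ, Real.cosh_neg, ← neg_sub q.θ, hk.even]; ring

theorem adist_comm (hk : AngleFun k) (p q : Cyl) : adist k p q = adist k q p := by
  rw [adist, chd_comm hk, adist]

theorem chd_shift (z : ℂ) (p q : Cyl) : chd k (p.shift z) (q.shift z) = chd k p q := by
  simp only [chd, shift, add_sub_add_right_eq_sub]

theorem adist_shift (z : ℂ) (p q : Cyl) : adist k (p.shift z) (q.shift z) = adist k p q := by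
  rw [adist, chd_shift, adist]

theorem adist_le_iff (hk : AngleFun k) {p q : Cyl} {d : ℝ} (hd : 0 ≤ d) :
    adist k p q ≤ d ↔ chd k p q ≤ Real.cosh d := by
  rw [← cosh_adist hk, Real.cosh_le_cosh, abs_of_nonneg (adist_nonneg hk p q), abs_of_nonneg hd]

theorem adist_eq_iff (hk : AngleFun k) {p q : Cyl} {d : ℝ} (hd : 0 ≤ d) :
    adist k p q = d ↔ chd k p q = Real.cosh d := by
  rw [← cosh_adist hk, Real.cosh_injOn.eq_iff (adist_nonneg hk p q) hd]

theorem cauchy_schwarz_three {a b c x y z N : ℝ} (hN : x ^ 2 + y ^ 2 + z ^ 2 = N) :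
    a * x + b * y + c * z ≤ √(a ^ 2 + b ^ 2 + c ^ 2) * √N := by
  rw [← Real.sqrt_mul (by positivity)]
  refine Real.le_sqrt_of_sq_le ?_
  rw [← hN]
  nlinarith [sq_nonneg (a * y - b * x), sq_nonneg (a * z - c * x), sq_nonneg (b * z - c * y)]

/-- Along the path, `u = chd k o ·` satisfies `u' ≤ S √(u² - 1)`, where `S` is the speed; dividing
by the root bounds the derivative of `arcosh u` by `S`. -/
theorem adist_le_add_integral (hk : AngleFun k) (o p q : Cyl) (r ζ θ : ℝ → ℝ)
    (hr : ContDiff ℝ 1 r) (hζ : ContDiff ℝ 1 ζ) (hθ : ContDiff ℝ 1 θ)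
    (r_nonneg : ∀ t ∈ Set.Icc (0 : ℝ) 1, 0 ≤ r t)
    (hs : r 0 = p.r ∧ ζ 0 = p.ζ ∧ θ 0 = p.θ) (he : r 1 = q.r ∧ ζ 1 = q.ζ ∧ θ 1 = q.θ) :
    adist k o q ≤ adist k o p + ∫ t in (0 : ℝ)..1, √(deriv r t ^ 2 +
        Real.cosh (r t) ^ 2 * deriv ζ t ^ 2 + Real.sinh (r t) ^ 2 * deriv θ t ^ 2) := by
  set S : ℝ → ℝ := fun t => √(deriv r t ^ 2 +
        Real.cosh (r t) ^ 2 * deriv ζ t ^ 2 + Real.sinh (r t) ^ 2 * deriv θ t ^ 2) with hS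
  set u : ℝ → ℝ := fun t => Real.cosh o.r * Real.cosh (r t) * Real.cosh (o.ζ - ζ t) -
    Real.sinh o.r * Real.sinh (r t) * k (o.θ - θ t) with hu
  have hScont : Continuous S := by
    have h1 := hr.continuous_deriv le_rfl
    have h2 := hζ.continuous_deriv le_rfl
    have h3 := hθ.continuous_deriv le_rfl
    have h4 := hr.continuous
    rw [hS]
    fun_prop
  have hu1 : ∀ t ∈ Set.Icc (0 : ℝ) 1, 1 ≤ u t := fun t ht =>
    one_le_chd hk o ⟨r t, ζ t, θ t, r_nonneg t ht⟩
  have hu0 : u 0 = chd k o p := by simp only [hu, hs, chd]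
  have hu1' : u 1 = chd k o q := by simp only [hu, he, chd]
  have hud : ∀ t ∈ Set.Icc (0 : ℝ) 1, ∃ u', HasDerivAt u u' t ∧ u' ≤ S t * √(u t ^ 2 - 1) := by
    intro t ht
    obtain ⟨s, hks, hs1⟩ := hk.deriv (o.θ - θ t)
    have dr := ((hr.differentiable one_ne_zero) t).hasDerivAt
    have dζ := ((hζ.differentiable one_ne_zero) t).hasDerivAt
    have dθ := ((hθ.differentiable one_ne_zero) t).hasDerivAt
    have d1 := ((dr.cosh.const_mul (Real.cosh o.r)).mul (dζ.const_sub o.ζ).cosh).sub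
      ((dr.sinh.const_mul (Real.sinh o.r)).mul (hks.comp t (dθ.const_sub o.θ)))
    refine ⟨_, d1, ?_⟩
    -- The squared norm of the gradient of `u` in the orthonormal frame of the metric. Of the angle
    -- function, only `s ^ 2 + k ^ 2 = 1` enters.
    have key : (Real.cosh o.r * Real.sinh (r t) * Real.cosh (o.ζ - ζ t) -
          Real.sinh o.r * Real.cosh (r t) * k (o.θ - θ t)) ^ 2 +
        (-(Real.cosh o.r * Real.sinh (o.ζ - ζ t))) ^ 2 + (Real.sinh o.r * s) ^ 2 = u t ^ 2 - 1 := by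
      have h1 := Real.cosh_sq o.r
      have h2 := Real.cosh_sq (r t)
      have h3 := Real.cosh_sq (o.ζ - ζ t)
      have h4 : s ^ 2 = 1 - k (o.θ - θ t) ^ 2 := by linarith
      simp only [hu]
      ring_nf at h1 h2 h3 h4 ⊢
      simp only [h1, h2, h3, h4]
      ring
    have := cauchy_schwarz_three (a := deriv r t) (b := Real.cosh (r t) * deriv ζ t)
      (c := Real.sinh (r t) * deriv θ t) key
    simp only [mul_pow] at this
    refine le_trans (le_of_eq ?_) this
    rw [Function.comp_apply]
    ring
  -- `arcosh` is not differentiable at `1`, a value `u` may take. The factor `m > 1` keeps the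
  -- argument away from it, and `m → 1` is taken at the end.
  have main : ∀ m : ℝ, 1 < m →
      Real.arcosh (m * u 1) - Real.arcosh (m * u 0) ≤ ∫ t in (0 : ℝ)..1, S t := by
    intro m hm
    choose! u' hu' hle using hud
    have hgt : ∀ t ∈ Set.Icc (0 : ℝ) 1, 1 < m * u t := fun t ht => by nlinarith [hu1 t ht]
    have hder : ∀ t ∈ Set.Icc (0 : ℝ) 1, HasDerivAt (fun t => Real.arcosh (m * u t))
        ((√((m * u t) ^ 2 - 1))⁻¹ * (m * u' t)) t := fun t ht =>
      HasDerivAt.comp (h₂ := Real.arcosh) t (Real.hasDerivAt_arcosh (hgt t ht))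
        ((hu' t ht).const_mul m)
    refine intervalIntegral.sub_le_integral_of_hasDeriv_right_of_le zero_le_one
      (fun t ht => (hder t ht).continuousAt.continuousWithinAt)
      (fun t ht => (hder t (Set.Ioo_subset_Icc_self ht)).hasDerivWithinAt)
      hScont.integrableOn_Icc (fun t ht' => ?_)
    have ht := Set.Ioo_subset_Icc_self ht'
    have h1 := hgt t ht
    have h2 := hu1 t ht
    have hpos : 0 < √((m * u t) ^ 2 - 1) := Real.sqrt_pos.2 (by nlinarith)
    rw [inv_mul_le_iff₀ hpos]
    have h3 : m * √(u t ^ 2 - 1) ≤ √((m * u t) ^ 2 - 1) := by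
      refine Real.le_sqrt_of_sq_le ?_
      rw [mul_pow, Real.sq_sqrt (by nlinarith)]
      nlinarith
    calc m * u' t ≤ m * (S t * √(u t ^ 2 - 1)) :=
          mul_le_mul_of_nonneg_left (hle t ht) (by linarith)
      _ = (m * √(u t ^ 2 - 1)) * S t := by ring
      _ ≤ _ := mul_le_mul_of_nonneg_right h3 (Real.sqrt_nonneg _)
  have hlim : ∀ x : ℝ, 1 ≤ x → Filter.Tendsto (fun m : ℝ => Real.arcosh (m * x))
      (nhdsWithin 1 (Set.Ioi 1)) (nhds (Real.arcosh x)) := by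
    intro x hx
    have h1 : Filter.Tendsto (fun m : ℝ => m * x) (nhdsWithin 1 (Set.Ioi 1))
        (nhdsWithin x (Set.Ici 1)) := by
      refine tendsto_nhdsWithin_iff.2 ⟨?_, ?_⟩
      · have : Filter.Tendsto (fun m : ℝ => m * x) (nhds 1) (nhds (1 * x)) :=
          (continuous_id.mul continuous_const).tendsto 1
        rw [one_mul] at this
        exact this.mono_left nhdsWithin_le_nhds
      · filter_upwards [self_mem_nhdsWithin] with m hm
        have : (1 : ℝ) < m := hm
        show 1 ≤ m * x
        nlinarith
    exact (Real.continuousOn_arcosh x hx).tendsto.comp h1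
  have h01 : (0 : ℝ) ∈ Set.Icc (0 : ℝ) 1 := ⟨le_rfl, zero_le_one⟩
  have h11 : (1 : ℝ) ∈ Set.Icc (0 : ℝ) 1 := ⟨zero_le_one, le_rfl⟩
  have := le_of_tendsto ((hlim _ (hu1 1 h11)).sub (hlim _ (hu1 0 h01)))
    (by filter_upwards [self_mem_nhdsWithin] with m hm using main m hm)
  rw [hu0, hu1'] at this
  rw [adist, adist]
  linarith

theorem PathOfLength.adist_le (hk : AngleFun k) (o : Cyl) {p q : Cyl} {a : ℝ}
    (h : PathOfLength p q a) : adist k o q ≤ adist k o p + a := by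
  induction h with
  | smooth p q r ζ θ hr hζ hθ h0 hs he =>
    exact adist_le_add_integral hk o p q r ζ θ hr hζ hθ h0 hs he
  | trans _ _ h₁ h₂ => linarith

theorem adist_le_add_dist (hk : AngleFun k) (o p q : Cyl) :
    adist k o q ≤ adist k o p + dist p q := by
  have : adist k o q - adist k o p ≤ sInf {a | PathOfLength p q a} :=
    le_csInf (PathOfLength.exists p q) fun a ha => by
      linarith [PathOfLength.adist_le hk o ha]
  rw [dist_def]; linarith

theorem adist_le_dist (hk : AngleFun k) (p q : Cyl) : adist k p q ≤ dist p q := by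
  have := adist_le_add_dist hk p p q
  rwa [adist_self hk, zero_add] at this

end Cyl

/-! ### Hyperboloid segments as paths in cylindrical coordinates -/

namespace Cyl

/-- The four coordinates in the hyperboloid model. -/
noncomputable def mk0 (p : Cyl) : ℝ := Real.cosh p.r * Real.cosh p.ζ
noncomputable def mk1 (p : Cyl) : ℝ := Real.cosh p.r * Real.sinh p.ζ
noncomputable def mk2 (p : Cyl) : ℝ := Real.sinh p.r * Real.cos p.θ
noncomputable def mk3 (p : Cyl) : ℝ := Real.sinh p.r * Real.sin p.θ

theorem mk0_pos (p : Cyl) : 0 < p.mk0 := mul_pos (Real.cosh_pos _) (Real.cosh_pos _)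

theorem mk_sq (p : Cyl) : p.mk0 ^ 2 - p.mk1 ^ 2 - p.mk2 ^ 2 - p.mk3 ^ 2 = 1 := by
  have h1 := Real.cosh_sq p.r
  have h2 := Real.cosh_sq p.ζ
  have h3 := Real.sin_sq_add_cos_sq p.θ
  simp only [mk0, mk1, mk2, mk3, mul_pow, h1, h2]
  linear_combination (-Real.sinh p.r ^ 2) * h3

theorem chd_cos (p q : Cyl) : chd Real.cos p q =
    p.mk0 * q.mk0 - p.mk1 * q.mk1 - p.mk2 * q.mk2 - p.mk3 * q.mk3 := by
  simp only [chd, mk0, mk1, mk2, mk3, Real.cosh_sub, Real.cos_sub]; ring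

/-- The coordinates of the hyperbolic segment of length `L`, at the fraction `t`. -/
noncomputable def seg (L a b t : ℝ) : ℝ :=
  (Real.sinh (L * (1 - t)) * a + Real.sinh (L * t) * b) / Real.sinh L

theorem seg_zero {L : ℝ} (hL : 0 < L) (a b : ℝ) : seg L a b 0 = a := by
  have := (Real.sinh_pos_iff.2 hL).ne'
  simp [seg]; field_simp

theorem seg_one {L : ℝ} (hL : 0 < L) (a b : ℝ) : seg L a b 1 = b := by
  have := (Real.sinh_pos_iff.2 hL).ne'
  simp [seg]; field_simp

theorem seg_pos {L a b t : ℝ} (hL : 0 < L) (ha : 0 < a) (hb : 0 < b) (ht : t ∈ Set.Icc (0 : ℝ) 1) :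
    0 < seg L a b t := by
  refine div_pos ?_ (Real.sinh_pos_iff.2 hL)
  rcases ht.1.eq_or_lt with h | h
  · subst h; simpa using mul_pos (Real.sinh_pos_iff.2 hL) ha
  · exact add_pos_of_nonneg_of_pos (mul_nonneg (Real.sinh_nonneg_iff.2
      (mul_nonneg hL.le (sub_nonneg.2 ht.2))) ha.le)
      (mul_pos (Real.sinh_pos_iff.2 (mul_pos hL h)) hb)

theorem seg_nonneg {L a b t : ℝ} (hL : 0 < L) (ha : 0 ≤ a) (hb : 0 ≤ b)
    (ht : t ∈ Set.Icc (0 : ℝ) 1) : 0 ≤ seg L a b t :=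
  div_nonneg (add_nonneg
    (mul_nonneg (Real.sinh_nonneg_iff.2 (mul_nonneg hL.le (sub_nonneg.2 ht.2))) ha)
    (mul_nonneg (Real.sinh_nonneg_iff.2 (mul_nonneg hL.le ht.1)) hb)) (Real.sinh_nonneg_iff.2 hL.le)

/-- Points of a hyperbolic segment have the expected distances. -/
theorem seg_form {L a0 a1 a2 a3 b0 b1 b2 b3 : ℝ} (hL : 0 < L)
    (ha : a0 ^ 2 - a1 ^ 2 - a2 ^ 2 - a3 ^ 2 = 1) (hb : b0 ^ 2 - b1 ^ 2 - b2 ^ 2 - b3 ^ 2 = 1)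
    (hab : a0 * b0 - a1 * b1 - a2 * b2 - a3 * b3 = Real.cosh L) (s t : ℝ) :
    seg L a0 b0 s * seg L a0 b0 t - seg L a1 b1 s * seg L a1 b1 t -
      seg L a2 b2 s * seg L a2 b2 t - seg L a3 b3 s * seg L a3 b3 t =
      Real.cosh (L * s - L * t) := by
  have h0 := (Real.sinh_pos_iff.2 hL).ne'
  have e : ∀ t : ℝ, Real.sinh (L * (1 - t)) =
      Real.sinh L * Real.cosh (L * t) - Real.cosh L * Real.sinh (L * t) := fun t => by
    rw [mul_sub, mul_one, Real.sinh_sub]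
  have h1 := Real.cosh_sq L
  simp only [seg, e, Real.cosh_sub]
  field_simp
  set A := Real.sinh L
  set B := Real.cosh L
  set c := Real.cosh (L * s)
  set d := Real.sinh (L * s)
  set c' := Real.cosh (L * t)
  set d' := Real.sinh (L * t)
  linear_combination (A * c - B * d) * (A * c' - B * d') * ha + d * d' * hb +
    ((A * c - B * d) * d' + (A * c' - B * d') * d) * hab - d * d' * h1

theorem seg_self_form {L a0 a1 a2 a3 b0 b1 b2 b3 : ℝ} (hL : 0 < L)
    (ha : a0 ^ 2 - a1 ^ 2 - a2 ^ 2 - a3 ^ 2 = 1) (hb : b0 ^ 2 - b1 ^ 2 - b2 ^ 2 - b3 ^ 2 = 1)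
    (hab : a0 * b0 - a1 * b1 - a2 * b2 - a3 * b3 = Real.cosh L) (t : ℝ) :
    seg L a0 b0 t ^ 2 - seg L a1 b1 t ^ 2 - seg L a2 b2 t ^ 2 - seg L a3 b3 t ^ 2 = 1 := by
  simpa [sq] using seg_form hL ha hb hab t t

theorem hasDerivAt_seg {φ : ℝ → ℝ} {φ' t : ℝ} (hφ : HasDerivAt φ φ' t) (L a b : ℝ) :
    HasDerivAt (fun t => seg L a b (φ t)) (L * φ' * (-Real.cosh (L * (1 - φ t)) * a +
      Real.cosh (L * φ t) * b) / Real.sinh L) t := by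
  have := ((((hφ.const_sub 1).const_mul L).sinh.mul_const a).add
    ((hφ.const_mul L).sinh.mul_const b)).div_const (Real.sinh L)
  refine this.congr_deriv ?_
  ring

theorem contDiff_seg {φ : ℝ → ℝ} (hφ : ContDiff ℝ 1 φ) (L a b : ℝ) :
    ContDiff ℝ 1 (fun t => seg L a b (φ t)) := by
  simp only [seg]
  refine ContDiff.div_const (ContDiff.add (ContDiff.mul ?_ contDiff_const)
    (ContDiff.mul ?_ contDiff_const)) _
  · exact Real.contDiff_sinh.comp (contDiff_const.mul (contDiff_const.sub hφ))
  · exact Real.contDiff_sinh.comp (contDiff_const.mul hφ)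

/-- A smooth parametrization of the unit interval that never leaves it. -/
noncomputable def ramp (t : ℝ) : ℝ := (1 - Real.cos (Real.pi * t)) / 2

theorem ramp_mem (t : ℝ) : ramp t ∈ Set.Icc (0 : ℝ) 1 := by
  have h1 := Real.neg_one_le_cos (Real.pi * t)
  have h2 := Real.cos_le_one (Real.pi * t)
  constructor <;> rw [ramp] <;> linarith

theorem ramp_zero : ramp 0 = 0 := by simp [ramp]
theorem ramp_one : ramp 1 = 1 := by simp [ramp]

theorem hasDerivAt_ramp (t : ℝ) : HasDerivAt ramp (Real.sin (Real.pi * t) * Real.pi / 2) t := by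
  have := ((((hasDerivAt_id t).const_mul Real.pi).cos).const_sub 1).div_const 2
  refine this.congr_deriv ?_
  simp

theorem contDiff_ramp : ContDiff ℝ 1 ramp := by
  unfold ramp
  exact (contDiff_const.sub (Real.contDiff_cos.comp (contDiff_const.mul contDiff_id))).div_const _

/-- The metric in cylindrical coordinates is the pullback of the Minkowski form; `d0, …, d3` are the
velocity components in the hyperboloid. -/
theorem polar_speed {C S C' S' c s r ζ θ d0 d1 d2 d3 : ℝ} (h : C ^ 2 = S ^ 2 + 1)
    (h' : C' ^ 2 = S' ^ 2 + 1) (hc : s ^ 2 + c ^ 2 = 1) (e0 : S * r * C' + C * (S' * ζ) = d0)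
    (e1 : S * r * S' + C * (C' * ζ) = d1) (e2 : C * r * c + S * (-s * θ) = d2)
    (e3 : C * r * s + S * (c * θ) = d3) :
    r ^ 2 + C ^ 2 * ζ ^ 2 + S ^ 2 * θ ^ 2 = -d0 ^ 2 + d1 ^ 2 + d2 ^ 2 + d3 ^ 2 := by
  subst e0 e1 e2 e3
  linear_combination (-r ^ 2) * h + (S ^ 2 * r ^ 2 - C ^ 2 * ζ ^ 2) * h' -
    (C ^ 2 * r ^ 2 + S ^ 2 * θ ^ 2) * hc

/-- The coordinates `r` and `ζ` of a hyperboloid segment are recovered by `arsinh`, but the angle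
has no global formula, so a polar form of the last two coordinates is supplied. Reparametrizing by
`ramp` keeps the time in `[0, 1]` for every real `t`, as global smoothness requires; the speed is
`L` times the derivative of `ramp`. -/
theorem pathOfLength_of_polar {p q : Cyl} {L : ℝ} (hL : 0 < L) (hpq : chd Real.cos p q = Real.cosh L)
    {ρ θ : ℝ → ℝ} (hρ : ContDiff ℝ 1 ρ) (hθ : ContDiff ℝ 1 θ) (hρ0 : ∀ t, 0 ≤ ρ t)
    (h2 : ∀ t, ρ t * Real.cos (θ t) = seg L p.mk2 q.mk2 (ramp t))
    (h3 : ∀ t, ρ t * Real.sin (θ t) = seg L p.mk3 q.mk3 (ramp t))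
    (hs : θ 0 = p.θ) (he : θ 1 = q.θ) : PathOfLength p q L := by
  rw [chd_cos] at hpq
  have hsinhL := Real.sinh_pos_iff.2 hL
  set x1 : ℝ → ℝ := fun t => seg L p.mk1 q.mk1 (ramp t) with hx1
  have hden : ∀ t, 0 < √(1 + ρ t ^ 2) := fun t => Real.sqrt_pos.2 (by positivity)
  set r : ℝ → ℝ := fun t => Real.arsinh (ρ t) with hr
  set ζ : ℝ → ℝ := fun t => Real.arsinh (x1 t / √(1 + ρ t ^ 2)) with hζ
  have hform : ∀ t, seg L p.mk0 q.mk0 (ramp t) ^ 2 = 1 + x1 t ^ 2 + ρ t ^ 2 := fun t => by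
    have := seg_self_form hL p.mk_sq q.mk_sq hpq (ramp t)
    rw [← h2, ← h3] at this
    linear_combination this + ρ t ^ 2 * Real.sin_sq_add_cos_sq (θ t)
  have e0 : ∀ t, Real.cosh (r t) * Real.cosh (ζ t) = seg L p.mk0 q.mk0 (ramp t) := fun t => by
    rw [hr, hζ]
    simp only
    rw [Real.cosh_arsinh, Real.cosh_arsinh, ← Real.sqrt_mul (by positivity), div_pow,
      Real.sq_sqrt (by positivity)]
    rw [show (1 + ρ t ^ 2) * (1 + x1 t ^ 2 / (1 + ρ t ^ 2)) = 1 + x1 t ^ 2 + ρ t ^ 2 by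
      field_simp; ring, ← hform]
    exact Real.sqrt_sq (seg_pos hL p.mk0_pos q.mk0_pos (ramp_mem t)).le
  have e1 : ∀ t, Real.cosh (r t) * Real.sinh (ζ t) = seg L p.mk1 q.mk1 (ramp t) := fun t => by
    rw [hr, hζ]
    simp only
    rw [Real.cosh_arsinh, Real.sinh_arsinh, mul_div_cancel₀ _ (hden t).ne']
  have e2 : ∀ t, Real.sinh (r t) * Real.cos (θ t) = seg L p.mk2 q.mk2 (ramp t) := fun t => by
    rw [hr, ← h2]; simp only; rw [Real.sinh_arsinh]
  have e3 : ∀ t, Real.sinh (r t) * Real.sin (θ t) = seg L p.mk3 q.mk3 (ramp t) := fun t => by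
    rw [hr, ← h3]; simp only; rw [Real.sinh_arsinh]
  have cr : ContDiff ℝ 1 r := hρ.arsinh
  have cζ : ContDiff ℝ 1 ζ := ((contDiff_seg contDiff_ramp L _ _).div
    ((contDiff_const.add (hρ.pow 2)).sqrt fun t => by positivity) fun t => (hden t).ne').arsinh
  have ends : ∀ (s : Cyl) (t : ℝ), seg L p.mk1 q.mk1 (ramp t) = s.mk1 →
      seg L p.mk2 q.mk2 (ramp t) = s.mk2 → seg L p.mk3 q.mk3 (ramp t) = s.mk3 →
      r t = s.r ∧ ζ t = s.ζ := by
    intro s t g1 g2 g3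
    have hρs : ρ t = Real.sinh s.r := by
      have h : ρ t ^ 2 = Real.sinh s.r ^ 2 := by
        rw [← h2, mk2] at g2
        rw [← h3, mk3] at g3
        have h1 := Real.sin_sq_add_cos_sq s.θ
        have h2 := Real.sin_sq_add_cos_sq (θ t)
        linear_combination (ρ t * Real.cos (θ t) + Real.sinh s.r * Real.cos s.θ) * g2 +
          (ρ t * Real.sin (θ t) + Real.sinh s.r * Real.sin s.θ) * g3 - ρ t ^ 2 * h2 +
          Real.sinh s.r ^ 2 * h1
      exact (pow_left_inj₀ (hρ0 t) s.sinh_r_nonneg two_ne_zero).1 h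
    have hrs : r t = s.r := by rw [hr]; simp only; rw [hρs, Real.arsinh_sinh]
    refine ⟨hrs, Real.sinh_injective ?_⟩
    have := e1 t
    rw [g1, mk1, hrs] at this
    exact mul_left_cancel₀ (Real.cosh_pos _).ne' this
  have hstart := ends p 0 (by rw [ramp_zero, seg_zero hL]) (by rw [ramp_zero, seg_zero hL])
    (by rw [ramp_zero, seg_zero hL])
  have hend := ends q 1 (by rw [ramp_one, seg_one hL]) (by rw [ramp_one, seg_one hL])
    (by rw [ramp_one, seg_one hL])
  have path := PathOfLength.smooth p q r ζ θ cr cζ hθ (fun t _ => Real.arsinh_nonneg_iff.2 (hρ0 t))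
    ⟨hstart.1, hstart.2, hs⟩ ⟨hend.1, hend.2, he⟩
  have hspeed : ∀ t ∈ Set.uIcc (0 : ℝ) 1, √(deriv r t ^ 2 + Real.cosh (r t) ^ 2 * deriv ζ t ^ 2 +
      Real.sinh (r t) ^ 2 * deriv θ t ^ 2) = L * (Real.sin (Real.pi * t) * Real.pi / 2) := by
    intro t ht
    rw [Set.uIcc_of_le zero_le_one] at ht
    have hsin : 0 ≤ L * (Real.sin (Real.pi * t) * Real.pi / 2) := by
      have := Real.sin_nonneg_of_nonneg_of_le_pi (mul_nonneg Real.pi_pos.le ht.1)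
        (mul_le_of_le_one_right Real.pi_pos.le ht.2)
      have := Real.pi_pos
      positivity
    have dr := ((cr.differentiable one_ne_zero) t).hasDerivAt
    have dζ := ((cζ.differentiable one_ne_zero) t).hasDerivAt
    have dθ := ((hθ.differentiable one_ne_zero) t).hasDerivAt
    have dφ := hasDerivAt_ramp t
    have d0 := ((dr.cosh.mul dζ.cosh).congr_of_eventuallyEq
      (.of_forall fun t => (e0 t).symm)).unique (hasDerivAt_seg dφ L _ _)
    have d1 := ((dr.cosh.mul dζ.sinh).congr_of_eventuallyEq
      (.of_forall fun t => (e1 t).symm)).unique (hasDerivAt_seg dφ L _ _)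
    have d2 := ((dr.sinh.mul dθ.cos).congr_of_eventuallyEq
      (.of_forall fun t => (e2 t).symm)).unique (hasDerivAt_seg dφ L _ _)
    have d3 := ((dr.sinh.mul dθ.sin).congr_of_eventuallyEq
      (.of_forall fun t => (e3 t).symm)).unique (hasDerivAt_seg dφ L _ _)
    rw [← Real.sqrt_sq hsin]
    congr 1
    have hpol := polar_speed (Real.cosh_sq (r t)) (Real.cosh_sq (ζ t))
      (Real.sin_sq_add_cos_sq (θ t)) d0 d1 d2 d3
    rw [hpol]
    have hadd : L * (1 - ramp t) + L * ramp t = L := by ring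
    have hc := Real.cosh_add (L * (1 - ramp t)) (L * ramp t)
    rw [hadd] at hc
    have h1 := Real.cosh_sq L
    have h2 := Real.cosh_sq (L * (1 - ramp t))
    have h3 := Real.cosh_sq (L * ramp t)
    set V := Real.sin (Real.pi * t) * Real.pi / 2
    set A := Real.cosh (L * (1 - ramp t))
    set B := Real.cosh (L * ramp t)
    set A' := Real.sinh (L * (1 - ramp t))
    set B' := Real.sinh (L * ramp t)
    set C := Real.cosh L
    -- By the addition formula for `L = L (1 - ramp t) + L * ramp t`, this is the Minkowski square
    -- of the velocity up to the common factor `V²`, with the hyperbolic sines eliminated.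
    have hS : Real.sinh L ^ 2 = -A ^ 2 - B ^ 2 + 2 * A * B * C := by
      have : C ^ 2 - 1 = -A ^ 2 - B ^ 2 + 2 * A * B * C := by
        rw [hc]
        linear_combination (1 - B ^ 2) * h2 - A' ^ 2 * h3
      linarith
    have hne := hsinhL.ne'
    field_simp
    rw [hS]
    linear_combination V ^ 2 * (-A ^ 2 * p.mk_sq - B ^ 2 * q.mk_sq + 2 * A * B * hpq)
  rw [intervalIntegral.integral_congr hspeed, intervalIntegral.integral_const_mul,
    intervalIntegral.integral_eq_sub_of_hasDerivAt (fun t _ => hasDerivAt_ramp t)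
      (Continuous.intervalIntegrable (by fun_prop) _ _), ramp_zero, ramp_one, sub_zero,
      mul_one] at path
  exact path

end Cyl

/-! ### The law of cosines in the branched cover, and shortest segments -/

namespace Cyl

variable {k : ℝ → ℝ}

theorem chd_eq_of_angle {k k' : ℝ → ℝ} {p q : Cyl} (h : k (p.θ - q.θ) = k' (p.θ - q.θ)) :
    chd k p q = chd k' p q := by rw [chd, chd, h]

theorem dist_turn_axis (p q : Cyl) (hp : p.r = 0) (hq : q.r = 0) (h : p.ζ = q.ζ) :
    dist p q = 0 := by
  have path := PathOfLength.smooth p q (fun _ => 0) (fun _ => p.ζ)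
    (fun t => (1 - t) * p.θ + t * q.θ) contDiff_const contDiff_const (by fun_prop)
    (fun _ _ => le_rfl) ⟨hp.symm, rfl, by simp⟩ ⟨hq.symm, h, by simp⟩
  simp only [deriv_const, Real.sinh_zero] at path
  simp only [ne_eq, OfNat.ofNat_ne_zero, not_false_eq_true, zero_pow, mul_zero, zero_mul,
    add_zero, Real.sqrt_zero, intervalIntegral.integral_zero] at path
  exact le_antisymm (csInf_le (bddBelow_lengths p q) path) dist_nonneg

theorem eq_zero_of_cosh_eq_one {x : ℝ} (h : Real.cosh x = 1) : x = 0 := by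
  by_contra h'
  exact (Real.one_lt_cosh.2 h').ne' h

/-- A half-plane of constant angle contains the hyperbolic segments between its points, and there
only `k 0 = 1` matters. The case of zero distance is separate because `seg` divides by `sinh L`. -/
theorem dist_le_adist_of_eq_angle (hk : AngleFun k) (p q : Cyl) (h : p.θ = q.θ) :
    dist p q ≤ adist k p q := by
  wlog h0 : p.θ = 0 generalizing p q
  · have := this (p.shift ⟨0, -p.θ⟩) (q.shift ⟨0, -p.θ⟩) (by simp [shift, h]) (by simp [shift])
    rwa [(isometry_shift _).dist_eq, adist_shift] at this
  have hq0 : q.θ = 0 := h ▸ h0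
  rcases (adist_nonneg hk p q).eq_or_lt with hL | hL
  · have h1 : chd k p q = 1 := by rw [← cosh_adist hk, ← hL, Real.cosh_zero]
    have h2 := cosh_sub_le_chd hk p q
    rw [h1] at h2
    have h3 : p.r - q.r = 0 := eq_zero_of_cosh_eq_one (h2.antisymm (Real.one_le_cosh _))
    have h4 : p.r = q.r := sub_eq_zero.1 h3
    have h5 : p.ζ - q.ζ = 0 := by
      rw [chd, h4, h, sub_self, hk.zero] at h1
      have := Real.cosh_sq q.r
      have h6 : Real.cosh q.r ^ 2 * (Real.cosh (p.ζ - q.ζ) - 1) = 0 := by linarith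
      have h7 := (mul_eq_zero.1 h6).resolve_left (by positivity)
      exact eq_zero_of_cosh_eq_one (by linarith)
    have : p = q := by
      cases p; cases q
      simp only [mk.injEq] at *
      exact ⟨h4, sub_eq_zero.1 h5, h⟩
    rw [← hL, this, dist_self]
  · have hc : chd Real.cos p q = Real.cosh (adist k p q) := by
      rw [cosh_adist hk, chd, chd, h, sub_self, hk.zero, Real.cos_zero]
    have e2 : ∀ s : Cyl, s.θ = 0 → s.mk2 = Real.sinh s.r ∧ s.mk3 = 0 := fun s hs => by
      simp [mk2, mk3, hs]
    refine csInf_le (bddBelow_lengths p q) (pathOfLength_of_polar hL hc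
      (contDiff_seg contDiff_ramp (adist k p q) p.mk2 q.mk2) contDiff_const (fun t => ?_) (fun t => ?_) (fun t => ?_)
      h0.symm hq0.symm)
    · exact seg_nonneg hL ((e2 p h0).1 ▸ p.sinh_r_nonneg) ((e2 q hq0).1 ▸ q.sinh_r_nonneg)
        (ramp_mem t)
    · simp
    · simp [(e2 p h0).2, (e2 q hq0).2, seg]

/-- On the axis the angle can be changed at no cost, which reduces to a common half-plane. -/
theorem dist_le_adist_of_axis (hk : AngleFun k) (p q : Cyl) (h : p.r = 0) :
    dist p q ≤ adist k p q := by
  have h1 := dist_triangle p ⟨0, p.ζ, q.θ, le_rfl⟩ q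
  rw [dist_turn_axis p ⟨0, p.ζ, q.θ, le_rfl⟩ h rfl rfl, zero_add] at h1
  refine h1.trans ((dist_le_adist_of_eq_angle hk ⟨0, p.ζ, q.θ, le_rfl⟩ q rfl).trans (le_of_eq ?_))
  simp [adist, chd, h]

theorem sqrt_polar {x y : ℝ} (hx : 0 < x) :
    √(x ^ 2 + y ^ 2) * Real.cos (Real.arctan (y / x)) = x ∧
      √(x ^ 2 + y ^ 2) * Real.sin (Real.arctan (y / x)) = y := by
  have h : √(x ^ 2 + y ^ 2) = x * √(1 + (y / x) ^ 2) := by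
    rw [← Real.sqrt_sq hx.le, ← Real.sqrt_mul (by positivity), Real.sqrt_sq hx.le]
    congr 1
    field_simp
  have h' : √(1 + (y / x) ^ 2) ≠ 0 := (Real.sqrt_pos.2 (by positivity)).ne'
  rw [Real.cos_arctan, Real.sin_arctan, h]
  constructor <;> field_simp

theorem mk2_pos {s : Cyl} (hr : 0 < s.r) (hs : |s.θ| < Real.pi / 2) : 0 < s.mk2 :=
  mul_pos (Real.sinh_pos_iff.2 hr) (Real.cos_pos_of_mem_Ioo (abs_lt.1 hs))

/-- The rotation putting `p` and `q` at opposite angles. -/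
noncomputable def balance (p q : Cyl) : ℂ := ⟨0, -((p.θ + q.θ) / 2)⟩

theorem balance_angles {p q : Cyl} (h : |p.θ - q.θ| < Real.pi) :
    |(p.shift (balance p q)).θ| < Real.pi / 2 ∧ |(q.shift (balance p q)).θ| < Real.pi / 2 := by
  rw [abs_lt] at h
  constructor <;> rw [abs_lt] <;> simp only [shift, balance] <;> constructor <;> linarith

theorem chd_cos_gt_one {p q : Cyl} (hp : 0 < p.r) (hq : 0 < q.r) (h : |p.θ - q.θ| < Real.pi)
    (hne : p.θ ≠ q.θ) : 1 < chd Real.cos p q := by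
  have h0 : Real.cos (p.θ - q.θ) < 1 := by
    rw [← cutCos_of_le h.le]; exact cutCos_lt_one (sub_ne_zero.2 hne)
  have h1 := Real.one_le_cosh (p.r - q.r)
  rw [Real.cosh_sub] at h1
  have h2 := Real.one_le_cosh (p.ζ - q.ζ)
  have h3 := mul_pos (Real.cosh_pos p.r) (Real.cosh_pos q.r)
  have h4 := mul_pos (Real.sinh_pos_iff.2 hp) (Real.sinh_pos_iff.2 hq)
  rw [chd]
  nlinarith [mul_nonneg h3.le (sub_nonneg.2 h2), mul_pos h4 (sub_pos.2 h0)]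

/-- After balancing, both angles lie within `π / 2` of zero, so `mk2` is positive at the ends and
along the whole segment; `arctan` is then a smooth choice of angle. -/
theorem dist_le_adist_of_narrow (p q : Cyl) (hp : 0 < p.r) (hq : 0 < q.r)
    (h : |p.θ - q.θ| < Real.pi) : dist p q ≤ adist Real.cos p q := by
  by_cases hne : p.θ = q.θ
  · exact dist_le_adist_of_eq_angle angleFun_cos p q hne
  wlog hb : |p.θ| < Real.pi / 2 ∧ |q.θ| < Real.pi / 2 generalizing p q
  · have := this (p.shift (balance p q)) (q.shift (balance p q)) hp hq (by simpa [shift] using h)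
      (by simpa [shift] using hne) (balance_angles h)
    rwa [(isometry_shift _).dist_eq, adist_shift] at this
  have hL : 0 < adist Real.cos p q := Real.arcosh_pos (chd_cos_gt_one hp hq h hne)
  have hx : ∀ t, 0 < seg (adist Real.cos p q) p.mk2 q.mk2 (ramp t) := fun t =>
    seg_pos hL (mk2_pos hp hb.1) (mk2_pos hq hb.2) (ramp_mem t)
  have c2 := contDiff_seg contDiff_ramp (adist Real.cos p q) p.mk2 q.mk2
  have c3 := contDiff_seg contDiff_ramp (adist Real.cos p q) p.mk3 q.mk3
  have ends : ∀ s : Cyl, 0 < s.r → |s.θ| < Real.pi / 2 → Real.arctan (s.mk3 / s.mk2) = s.θ := by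
    intro s hs hs'
    rw [mk3, mk2, mul_div_mul_left _ _ (Real.sinh_pos_iff.2 hs).ne', ← Real.tan_eq_sin_div_cos,
      Real.arctan_tan (abs_lt.1 hs').1 (abs_lt.1 hs').2]
  refine csInf_le (bddBelow_lengths p q) (pathOfLength_of_polar hL (cosh_adist angleFun_cos p q).symm
      (ρ := fun t => √(seg (adist Real.cos p q) p.mk2 q.mk2 (ramp t) ^ 2 +
        seg (adist Real.cos p q) p.mk3 q.mk3 (ramp t) ^ 2))
      (θ := fun t => Real.arctan (seg (adist Real.cos p q) p.mk3 q.mk3 (ramp t) /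
        seg (adist Real.cos p q) p.mk2 q.mk2 (ramp t)))
      (((c2.pow 2).add (c3.pow 2)).sqrt fun t => ?_)
      (Real.contDiff_arctan.comp (c3.div c2 fun t => (hx t).ne')) (fun t => Real.sqrt_nonneg _)
      (fun t => (sqrt_polar (hx t)).1) (fun t => (sqrt_polar (hx t)).2) ?_ ?_)
  · have := hx t
    positivity
  · simp only [ramp_zero, seg_zero hL, ends p hp hb.1]
  · simp only [ramp_one, seg_one hL, ends q hq hb.2]

/-- The half-planes of `p` and `q` unfold into one hyperbolic plane, with `p` at signed height `a`
and `q` at `-b`. The segment there crosses the axis; cutting it at the crossing and turning for free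
gives a path in the cover of the same length. -/
theorem dist_le_adist_of_wide (p q : Cyl) (hp : 0 < p.r) (hq : 0 < q.r)
    (h : Real.pi ≤ |p.θ - q.θ|) : dist p q ≤ adist cutCos p q := by
  have hk := angleFun_cutCos
  set L := adist cutCos p q with hLdef
  set a := Real.sinh p.r
  set b := Real.sinh q.r
  have ha : 0 < a := Real.sinh_pos_iff.2 hp
  have hb : 0 < b := Real.sinh_pos_iff.2 hq
  have hcosh : Real.cosh L = Real.cosh p.r * Real.cosh q.r * Real.cosh (p.ζ - q.ζ) + a * b := by
    rw [hLdef, cosh_adist hk, chd, cutCos_of_ge h]; ring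
  have hL : 0 < L := by
    refine Real.arcosh_pos ?_
    rw [← cosh_adist hk, ← hLdef, hcosh]
    have h1 := Real.one_le_cosh p.r
    have h2 := Real.one_le_cosh q.r
    have h3 := Real.one_le_cosh (p.ζ - q.ζ)
    have := mul_pos ha hb
    have := one_le_mul_of_one_le_of_one_le (one_le_mul_of_one_le_of_one_le h1 h2) h3
    linarith
  have sa := p.mk_sq
  have sb := q.mk_sq
  have ta := Real.sin_sq_add_cos_sq p.θ
  have tb := Real.sin_sq_add_cos_sq q.θ
  have fa : p.mk0 ^ 2 - p.mk1 ^ 2 - a ^ 2 - 0 ^ 2 = 1 := by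
    rw [mk2, mk3] at sa; linear_combination sa + a ^ 2 * ta
  have fb : q.mk0 ^ 2 - q.mk1 ^ 2 - (-b) ^ 2 - 0 ^ 2 = 1 := by
    rw [mk2, mk3] at sb; linear_combination sb + b ^ 2 * tb
  have fab : p.mk0 * q.mk0 - p.mk1 * q.mk1 - a * (-b) - 0 * 0 = Real.cosh L := by
    rw [hcosh, mk0, mk0, mk1, mk1, Real.cosh_sub]; ring
  obtain ⟨t, ht, hzero⟩ : ∃ t ∈ Set.Icc (0 : ℝ) 1, seg L a (-b) t = 0 := by
    have hcont : ContinuousOn (seg L a (-b)) (Set.Icc 0 1) := by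
      unfold seg; fun_prop
    have := intermediate_value_Icc' zero_le_one hcont
    exact this ⟨by rw [seg_one hL]; linarith, by rw [seg_zero hL]; exact ha.le⟩
  set x0 := seg L p.mk0 q.mk0 t with hx0
  set x1 := seg L p.mk1 q.mk1 t with hx1
  have x0pos : 0 < x0 := seg_pos hL p.mk0_pos q.mk0_pos ht
  have form := seg_form hL fa fb fab
  have z3 : ∀ t, seg L 0 0 t = 0 := fun t => by simp [seg]
  have hx : x0 = Real.cosh (Real.arsinh x1) := by
    rw [Real.cosh_arsinh, eq_comm, Real.sqrt_eq_iff_mul_self_eq (by positivity) x0pos.le]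
    have := form t t
    rw [hzero, z3, sub_self, Real.cosh_zero] at this
    linarith
  have hpz := form 0 t
  have hzq := form t 1
  rw [hzero, z3, seg_zero hL, seg_zero hL] at hpz
  rw [hzero, z3, seg_one hL, seg_one hL, ← hx0, ← hx1] at hzq
  rw [← hx0, ← hx1] at hpz
  have dpz : adist cutCos p ⟨0, Real.arsinh x1, p.θ, le_rfl⟩ = L * t := by
    rw [adist_eq_iff hk (mul_nonneg hL.le ht.1), chd]
    simp only [Real.cosh_zero, Real.sinh_zero, Real.cosh_sub, ← hx, Real.sinh_arsinh]
    rw [← Real.cosh_neg (L * t), ← zero_sub, ← mul_zero L, ← hpz, mk0, mk1]; ring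
  have dzq : adist cutCos ⟨0, Real.arsinh x1, q.θ, le_rfl⟩ q = L * (1 - t) := by
    rw [adist_eq_iff hk (mul_nonneg hL.le (sub_nonneg.2 ht.2)), chd]
    simp only [Real.cosh_zero, Real.sinh_zero, Real.cosh_sub, ← hx, Real.sinh_arsinh]
    rw [← Real.cosh_neg (L * (1 - t)), show -(L * (1 - t)) = L * t - L * 1 by ring, ← hzq, mk0, mk1]
    ring
  have h1 := dist_le_adist_of_eq_angle hk p ⟨0, Real.arsinh x1, p.θ, le_rfl⟩ rfl
  have h2 := dist_le_adist_of_eq_angle hk ⟨0, Real.arsinh x1, q.θ, le_rfl⟩ q rfl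
  have h3 := dist_turn_axis ⟨0, Real.arsinh x1, p.θ, le_rfl⟩ ⟨0, Real.arsinh x1, q.θ, le_rfl⟩
    rfl rfl rfl
  have h4 := dist_triangle4 p ⟨0, Real.arsinh x1, p.θ, le_rfl⟩ ⟨0, Real.arsinh x1, q.θ, le_rfl⟩ q
  linarith

/-- The law of cosines in the cyclic branched cover. -/
theorem dist_eq_adist (p q : Cyl) : dist p q = adist cutCos p q := by
  have hk := angleFun_cutCos
  refine le_antisymm ?_ (adist_le_dist hk p q)
  rcases p.r_nonneg.eq_or_lt with hp | hp
  · exact dist_le_adist_of_axis hk p q hp.symm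
  rcases q.r_nonneg.eq_or_lt with hq | hq
  · rw [dist_comm, adist_comm hk]; exact dist_le_adist_of_axis hk q p hq.symm
  rcases lt_or_ge |p.θ - q.θ| Real.pi with h | h
  · refine (dist_le_adist_of_narrow p q hp hq h).trans (le_of_eq ?_)
    rw [adist, adist, chd_eq_of_angle (cutCos_of_le h.le)]
  · exact dist_le_adist_of_wide p q hp hq h

theorem adist_cos_le_dist (p q : Cyl) : adist Real.cos p q ≤ dist p q :=
  adist_le_dist angleFun_cos p q

/-- A whole number of turns brings the angle difference into `[-π, π)`, where `cutCos` and `cos`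
agree. -/
theorem exists_turn (p q : Cyl) : ∃ m : ℤ,
    dist p (q.shift ⟨0, m * (2 * Real.pi)⟩) = adist Real.cos p q := by
  obtain ⟨m, hm, -⟩ := existsUnique_sub_zsmul_mem_Ico Real.two_pi_pos (p.θ - q.θ) (-Real.pi)
  refine ⟨m, ?_⟩
  have e : p.θ - (q.shift ⟨0, m * (2 * Real.pi)⟩).θ = p.θ - q.θ - m • (2 * Real.pi) := by
    simp only [shift, zsmul_eq_mul]; ring
  rw [dist_eq_adist, adist, adist]
  congr 1
  rw [chd_eq_of_angle (k' := Real.cos), chd, chd, e]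
  · simp only [shift, add_zero, zsmul_eq_mul, Real.cos_sub_int_mul_two_pi]
  · rw [e]
    refine cutCos_of_le (abs_le.2 ⟨hm.1, ?_⟩)
    linarith [hm.2]

theorem chd_cos_turn (p q : Cyl) (m : ℤ) :
    chd Real.cos p (q.shift ⟨0, m * (2 * Real.pi)⟩) = chd Real.cos p q := by
  simp only [chd, shift, add_zero]
  rw [← sub_sub, Real.cos_sub_int_mul_two_pi]

/-- The distance of the cover from `p` to a suitably turned `q` realizes the last term, and the
lower bound along paths applies to it. -/
theorem adist_cos_triangle (o p q : Cyl) :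
    adist Real.cos o q ≤ adist Real.cos o p + adist Real.cos p q := by
  obtain ⟨m, hm⟩ := exists_turn p q
  have := adist_le_add_dist angleFun_cos o p (q.shift ⟨0, m * (2 * Real.pi)⟩)
  rwa [hm, adist, chd_cos_turn, ← adist] at this

theorem exists_mk {x0 x1 x2 x3 : ℝ} (h0 : 0 < x0) (h : x0 ^ 2 - x1 ^ 2 - x2 ^ 2 - x3 ^ 2 = 1) :
    ∃ c : Cyl, c.mk0 = x0 ∧ c.mk1 = x1 ∧ c.mk2 = x2 ∧ c.mk3 = x3 ∧ |c.θ| ≤ Real.pi ∧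
      (0 < x2 → |c.θ| < Real.pi / 2 ∧ 0 < c.r) := by
  set w : ℂ := ⟨x2, x3⟩
  have hw : ‖w‖ ^ 2 = x2 ^ 2 + x3 ^ 2 := by rw [Complex.sq_norm, Complex.normSq_mk]; ring
  have hden : 0 < √(1 + ‖w‖ ^ 2) := Real.sqrt_pos.2 (by positivity)
  refine ⟨⟨Real.arsinh ‖w‖, Real.arsinh (x1 / √(1 + ‖w‖ ^ 2)), w.arg,
    Real.arsinh_nonneg_iff.2 (norm_nonneg w)⟩, ?_, ?_, ?_, ?_, Complex.abs_arg_le_pi w,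
    fun h2 => ⟨?_, ?_⟩⟩
  · rw [mk0]
    simp only
    rw [Real.cosh_arsinh, Real.cosh_arsinh, ← Real.sqrt_mul (by positivity), div_pow,
      Real.sq_sqrt (by positivity), show (1 + ‖w‖ ^ 2) * (1 + x1 ^ 2 / (1 + ‖w‖ ^ 2)) = x0 ^ 2 by
        field_simp; rw [hw]; linarith]
    exact Real.sqrt_sq h0.le
  · rw [mk1]
    simp only
    rw [Real.cosh_arsinh, Real.sinh_arsinh, mul_div_cancel₀ _ hden.ne']
  · rw [mk2]
    simp only
    rw [Real.sinh_arsinh, Complex.norm_mul_cos_arg]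
  · rw [mk3]
    simp only
    rw [Real.sinh_arsinh, Complex.norm_mul_sin_arg]
  · exact Complex.abs_arg_lt_pi_div_two_iff.2 (Or.inl h2)
  · refine Real.arsinh_pos_iff.2 (norm_pos_iff.2 fun h' => h2.ne' ?_)
    exact congrArg Complex.re h'

/-- Unit speed segments for the distance `adist k`, up to points at distance zero. -/
def IsSegment (k : ℝ → ℝ) (p q : Cyl) (L : ℝ) (γ : ℝ → Cyl) : Prop :=
  (∀ s t, s ∈ Set.Icc 0 L → t ∈ Set.Icc 0 L → adist k (γ s) (γ t) = |s - t|) ∧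
    adist k p (γ 0) = 0 ∧ adist k (γ L) q = 0

theorem exists_segment_aux (p q : Cyl) (hL : 0 < adist Real.cos p q) : ∃ γ : ℝ → Cyl,
    IsSegment Real.cos p q (adist Real.cos p q) γ ∧ (0 < p.mk2 → 0 < q.mk2 →
      ∀ t ∈ Set.Icc 0 (adist Real.cos p q), |(γ t).θ| < Real.pi / 2 ∧ 0 < (γ t).r) := by
  set L := adist Real.cos p q with hLdef
  have hab : p.mk0 * q.mk0 - p.mk1 * q.mk1 - p.mk2 * q.mk2 - p.mk3 * q.mk3 = Real.cosh L := by
    rw [hLdef, cosh_adist angleFun_cos, chd_cos]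
  have hmem : ∀ t ∈ Set.Icc 0 L, t / L ∈ Set.Icc (0 : ℝ) 1 := fun t ht =>
    ⟨div_nonneg ht.1 hL.le, (div_le_one hL).2 ht.2⟩
  have hex : ∀ t, ∃ c : Cyl, t ∈ Set.Icc 0 L → c.mk0 = seg L p.mk0 q.mk0 (t / L) ∧
      c.mk1 = seg L p.mk1 q.mk1 (t / L) ∧ c.mk2 = seg L p.mk2 q.mk2 (t / L) ∧
      c.mk3 = seg L p.mk3 q.mk3 (t / L) ∧ (0 < seg L p.mk2 q.mk2 (t / L) →
        |c.θ| < Real.pi / 2 ∧ 0 < c.r) := by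
    intro t
    by_cases ht : t ∈ Set.Icc 0 L
    · obtain ⟨c, h0, h1, h2, h3, -, h4⟩ := exists_mk (seg_pos hL p.mk0_pos q.mk0_pos (hmem t ht))
        (seg_self_form hL p.mk_sq q.mk_sq hab (t / L))
      exact ⟨c, fun _ => ⟨h0, h1, h2, h3, h4⟩⟩
    · exact ⟨p, fun h => absurd h ht⟩
  choose γ hγ using hex
  have m0 : (0 : ℝ) ∈ Set.Icc 0 L := ⟨le_rfl, hL.le⟩
  have m1 : L ∈ Set.Icc 0 L := ⟨hL.le, le_rfl⟩
  refine ⟨γ, ⟨fun s t hs ht => ?_, ?_, ?_⟩, fun hp hq t ht =>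
    (hγ t ht).2.2.2.2 (seg_pos hL hp hq (hmem t ht))⟩
  · obtain ⟨a0, a1, a2, a3, -⟩ := hγ s hs
    obtain ⟨b0, b1, b2, b3, -⟩ := hγ t ht
    rw [adist_eq_iff angleFun_cos (abs_nonneg _), chd_cos, a0, a1, a2, a3, b0, b1, b2, b3,
      seg_form hL p.mk_sq q.mk_sq hab, mul_div_cancel₀ _ hL.ne', mul_div_cancel₀ _ hL.ne',
      Real.cosh_abs]
  · obtain ⟨b0, b1, b2, b3, -⟩ := hγ 0 m0
    rw [zero_div, seg_zero hL] at b0 b1 b2 b3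
    rw [adist, chd_cos, b0, b1, b2, b3, ← chd_cos, ← adist, adist_self angleFun_cos]
  · obtain ⟨b0, b1, b2, b3, -⟩ := hγ L m1
    rw [div_self hL.ne', seg_one hL] at b0 b1 b2 b3
    rw [adist, chd_cos, b0, b1, b2, b3, ← chd_cos, ← adist, adist_self angleFun_cos]

theorem exists_segment_cos (p q : Cyl) (hL : 0 < adist Real.cos p q) :
    ∃ γ : ℝ → Cyl, IsSegment Real.cos p q (adist Real.cos p q) γ :=
  (exists_segment_aux p q hL).imp fun _ h => h.1

/-- Avoiding the axis is what matters: off it every nonzero translation moves points, so the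
midpoint of the segment has positive minimal displacement. -/
theorem exists_segment_cutCos (p q : Cyl) (hL : 0 < adist cutCos p q) (hp : 0 < p.r) (hq : 0 < q.r)
    (h : |p.θ - q.θ| < Real.pi) : ∃ γ : ℝ → Cyl, IsSegment cutCos p q (adist cutCos p q) γ ∧
      ∀ t ∈ Set.Icc 0 (adist cutCos p q), 0 < (γ t).r := by
  wlog hb : |p.θ| < Real.pi / 2 ∧ |q.θ| < Real.pi / 2 generalizing p q
  · obtain ⟨γ, ⟨h1, h2, h3⟩, h4⟩ := this (p.shift (balance p q)) (q.shift (balance p q))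
      (by rwa [adist_shift]) hp hq (by simpa [shift] using h) (balance_angles h)
    rw [adist_shift] at h1 h3 h4
    refine ⟨fun t => (γ t).shift (-balance p q), ⟨fun s t hs ht => ?_, ?_, ?_⟩, h4⟩
    · rw [adist_shift, h1 s t hs ht]
    · rw [← adist_shift (balance p q), shift_shift, add_neg_cancel, shift_zero, h2]
    · rw [← adist_shift (balance p q), shift_shift, add_neg_cancel, shift_zero, h3]
  have conv : ∀ {a b : Cyl}, |a.θ| < Real.pi / 2 → |b.θ| < Real.pi / 2 →
      adist cutCos a b = adist Real.cos a b := by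
    intro a b ha hb
    rw [adist, adist, chd_eq_of_angle (cutCos_of_le _)]
    rw [abs_lt] at ha hb
    rw [abs_le]; constructor <;> linarith
  rw [conv hb.1 hb.2] at hL ⊢
  obtain ⟨γ, ⟨h1, h2, h3⟩, h4⟩ := exists_segment_aux p q hL
  have h4 := h4 (mk2_pos hp hb.1) (mk2_pos hq hb.2)
  have m0 : (0 : ℝ) ∈ Set.Icc 0 (adist Real.cos p q) := ⟨le_rfl, hL.le⟩
  have m1 : adist Real.cos p q ∈ Set.Icc 0 (adist Real.cos p q) := ⟨hL.le, le_rfl⟩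
  refine ⟨γ, ⟨fun s t hs ht => ?_, ?_, ?_⟩, fun t ht => (h4 t ht).2⟩
  · rw [conv (h4 s hs).1 (h4 t ht).1, h1 s t hs ht]
  · rw [conv hb.1 (h4 0 m0).1, h2]
  · rw [conv (h4 _ m1).1 hb.2, h3]

end Cyl

/-! ### Geometry of hyperbolic space -/

theorem Cyl.adist_cos_congr {p q : Cyl} (h : Cyl.adist Real.cos p q = 0) (c : Cyl) :
    Cyl.adist Real.cos p c = Cyl.adist Real.cos q c := by
  have h1 := Cyl.adist_cos_triangle p q c
  have h2 := Cyl.adist_cos_triangle q p c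
  rw [Cyl.adist_comm angleFun_cos q p] at h2
  linarith

namespace HypThree

/-- The four coordinates in the hyperboloid model. -/
noncomputable def y0 (p : HypThree) : ℝ := (p.w.re ^ 2 + p.w.im ^ 2 + p.h ^ 2 + 1) / (2 * p.h)
noncomputable def y1 (p : HypThree) : ℝ := (p.w.re ^ 2 + p.w.im ^ 2 + p.h ^ 2 - 1) / (2 * p.h)
noncomputable def y2 (p : HypThree) : ℝ := p.w.re / p.h
noncomputable def y3 (p : HypThree) : ℝ := p.w.im / p.h

theorem y0_pos (p : HypThree) : 0 < p.y0 := by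
  have := p.h_pos
  unfold y0; positivity

theorem y_sq (p : HypThree) : p.y0 ^ 2 - p.y1 ^ 2 - p.y2 ^ 2 - p.y3 ^ 2 = 1 := by
  have := p.h_pos.ne'
  simp only [y0, y1, y2, y3]
  field_simp
  ring

theorem dist_eq (p q : HypThree) : dist p q =
    Real.arcosh (p.y0 * q.y0 - p.y1 * q.y1 - p.y2 * q.y2 - p.y3 * q.y3) := by
  have h1 := p.h_pos.ne'
  have h2 := q.h_pos.ne'
  change Real.arcosh (1 + (‖p.w - q.w‖ ^ 2 + (p.h - q.h) ^ 2) / (2 * p.h * q.h)) = _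
  congr 1
  rw [Complex.sq_norm, Complex.normSq_apply]
  simp only [y0, y1, y2, y3, Complex.sub_re, Complex.sub_im]
  field_simp
  ring

theorem exists_y {x0 x1 x2 x3 : ℝ} (h0 : 0 < x0) (h : x0 ^ 2 - x1 ^ 2 - x2 ^ 2 - x3 ^ 2 = 1) :
    ∃ p : HypThree, p.y0 = x0 ∧ p.y1 = x1 ∧ p.y2 = x2 ∧ p.y3 = x3 := by
  -- In these coordinates `y0 - y1 = 1 / h`, which determines the preimage.
  have hlt : 0 < x0 - x1 := by
    nlinarith [sq_nonneg x2, sq_nonneg x3, sq_nonneg (x0 + x1)]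
  have hne := hlt.ne'
  refine ⟨⟨⟨x2 / (x0 - x1), x3 / (x0 - x1)⟩, 1 / (x0 - x1), by positivity⟩, ?_, ?_, ?_, ?_⟩
  · simp only [y0]
    field_simp
    linear_combination -h
  · simp only [y1]
    field_simp
    linear_combination -h
  · simp only [y2]
    field_simp
  · simp only [y3]
    field_simp

/-- Cylindrical coordinates on `ℍ³` in which the base point is the given point. -/
theorem exists_chart (x : Cyl) : ∃ Ψ : HypThree → Cyl,
    (∀ p q, Cyl.adist Real.cos (Ψ p) (Ψ q) = dist p q) ∧
    Cyl.adist Real.cos (Ψ base) x = 0 ∧ (∀ p, |(Ψ p).θ - x.θ| ≤ Real.pi) ∧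
    ∀ c, ∃ p, Cyl.adist Real.cos (Ψ p) c = 0 := by
  have hC := Real.cosh_sq x.r
  have hCS : Real.sinh x.r < Real.cosh x.r := Real.sinh_lt_cosh x.r
  have hS := x.sinh_r_nonneg
  set C := Real.cosh x.r
  set S := Real.sinh x.r
  -- A Lorentz boost in the coordinates `0` and `2` takes the base point to radius `x.r` at `ζ = θ =
  -- 0`; a translation by `(x.ζ, x.θ)` follows.
  have hex : ∀ p : HypThree, ∃ c : Cyl, c.mk0 = C * p.y0 + S * p.y2 ∧ c.mk1 = p.y1 ∧
      c.mk2 = S * p.y0 + C * p.y2 ∧ c.mk3 = p.y3 ∧ |c.θ| ≤ Real.pi := by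
    intro p
    have h := p.y_sq
    have h0 := p.y0_pos
    have h2 : -p.y0 < p.y2 := by nlinarith [sq_nonneg p.y1, sq_nonneg p.y3]
    obtain ⟨c, h0, h1, h2, h3, h4, -⟩ := Cyl.exists_mk (x0 := C * p.y0 + S * p.y2) (x1 := p.y1)
      (x2 := S * p.y0 + C * p.y2) (x3 := p.y3) (by nlinarith)
      (by linear_combination h + (p.y0 ^ 2 - p.y2 ^ 2) * hC)
    exact ⟨c, h0, h1, h2, h3, h4⟩
  choose Ψ h0 h1 h2 h3 h4 using hex
  have key : ∀ p q, Cyl.adist Real.cos (Ψ p) (Ψ q) = dist p q := fun p q => by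
    rw [dist_eq, Cyl.adist, Cyl.chd_cos, h0, h1, h2, h3, h0, h1, h2, h3]
    congr 1
    linear_combination (p.y0 * q.y0 - p.y2 * q.y2) * hC
  have back : ∀ c : Cyl, (c.shift (-⟨x.ζ, x.θ⟩)).shift ⟨x.ζ, x.θ⟩ = c := fun c => by
    rw [Cyl.shift_shift, add_neg_cancel, Cyl.shift_zero]
  refine ⟨fun p => (Ψ p).shift ⟨x.ζ, x.θ⟩, fun p q => ?_, ?_, fun p => ?_, fun c => ?_⟩
  · rw [Cyl.adist_shift, key]
  · rw [← Cyl.adist_shift (-⟨x.ζ, x.θ⟩), Cyl.shift_shift, neg_add_cancel, Cyl.shift_zero,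
      Cyl.adist, Cyl.chd_cos, h0, h1, h2, h3]
    have e : x.shift (-⟨x.ζ, x.θ⟩) = ⟨x.r, 0, 0, x.r_nonneg⟩ := by simp [Cyl.shift]
    rw [e]
    have : C * C - S * S = 1 := by linear_combination hC
    simp [base, y0, y1, y2, y3, Cyl.mk0, Cyl.mk1, Cyl.mk2, Cyl.mk3, C, S] at this ⊢
    rw [this, Real.arcosh_zero]
  · simpa [Cyl.shift] using h4 p
  · set d := c.shift (-⟨x.ζ, x.θ⟩) with hd
    have hdsq := d.mk_sq
    have hd2 : d.mk2 < d.mk0 := by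
      nlinarith [sq_nonneg d.mk1, sq_nonneg d.mk3, d.mk0_pos]
    obtain ⟨p, p0, p1, p2, p3⟩ := exists_y (x0 := C * d.mk0 - S * d.mk2) (x1 := d.mk1)
      (x2 := -S * d.mk0 + C * d.mk2) (x3 := d.mk3) (by nlinarith [d.mk0_pos])
      (by linear_combination hdsq + (d.mk0 ^ 2 - d.mk2 ^ 2) * hC)
    refine ⟨p, ?_⟩
    have e0 : (Ψ p).mk0 = d.mk0 := by rw [h0, p0, p2]; linear_combination d.mk0 * hC
    have e2 : (Ψ p).mk2 = d.mk2 := by rw [h2, p0, p2]; linear_combination d.mk2 * hC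
    rw [← back c, ← hd, Cyl.adist_shift, Cyl.adist, Cyl.chd_cos, e0, h1, e2, h3, p1, p3,
      ← Cyl.chd_cos, ← Cyl.adist, Cyl.adist_self angleFun_cos]

noncomputable instance : MetricSpace HypThree where
  dist_self p := by
    obtain ⟨Ψ, h, -⟩ := exists_chart ⟨0, 0, 0, le_rfl⟩
    rw [← h, Cyl.adist_self angleFun_cos]
  dist_comm p q := by
    obtain ⟨Ψ, h, -⟩ := exists_chart ⟨0, 0, 0, le_rfl⟩
    rw [← h, ← h, Cyl.adist_comm angleFun_cos]
  dist_triangle p q s := by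
    obtain ⟨Ψ, h, -⟩ := exists_chart ⟨0, 0, 0, le_rfl⟩
    rw [← h, ← h, ← h]
    exact Cyl.adist_cos_triangle _ _ _
  eq_of_dist_eq_zero := by
    intro p q h
    change Real.arcosh (1 + (‖p.w - q.w‖ ^ 2 + (p.h - q.h) ^ 2) / (2 * p.h * q.h)) = 0 at h
    have hp := p.h_pos
    have hq := q.h_pos
    rw [Real.arcosh_eq_zero_iff (by simp; positivity), add_eq_left, div_eq_zero_iff] at h
    have h := h.resolve_right (by positivity)
    have h1 : ‖p.w - q.w‖ = 0 := by
      have := sq_nonneg (p.h - q.h)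
      nlinarith [sq_nonneg ‖p.w - q.w‖]
    have h2 : p.h - q.h = 0 := by
      have := sq_nonneg ‖p.w - q.w‖
      nlinarith [sq_nonneg (p.h - q.h)]
    cases p; cases q
    simp only [mk.injEq]
    exact ⟨sub_eq_zero.1 (norm_eq_zero.1 h1), sub_eq_zero.1 h2⟩

theorem cosh_dist (p q : HypThree) : Real.cosh (dist p q) =
    p.y0 * q.y0 - p.y1 * q.y1 - p.y2 * q.y2 - p.y3 * q.y3 := by
  obtain ⟨Ψ, h, -⟩ := exists_chart ⟨0, 0, 0, le_rfl⟩
  have h1 := Cyl.one_le_chd angleFun_cos (Ψ p) (Ψ q)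
  have h2 : Real.arcosh (Cyl.chd Real.cos (Ψ p) (Ψ q)) = _ := (h p q).trans (dist_eq p q)
  rw [dist_eq, Real.cosh_arcosh]
  by_contra hlt
  rw [not_le] at hlt
  have hp := p.h_pos
  have hq := q.h_pos
  have e : p.y0 * q.y0 - p.y1 * q.y1 - p.y2 * q.y2 - p.y3 * q.y3 =
      1 + ((p.w.re - q.w.re) ^ 2 + (p.w.im - q.w.im) ^ 2 + (p.h - q.h) ^ 2) / (2 * p.h * q.h) := by
    simp only [y0, y1, y2, y3]
    field_simp
    ring
  have : 0 ≤ ((p.w.re - q.w.re) ^ 2 + (p.w.im - q.w.im) ^ 2 + (p.h - q.h) ^ 2) /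
    (2 * p.h * q.h) := by positivity
  linarith

/-- The midpoint is the normalized sum of the two hyperboloid vectors; `K` is the Minkowski norm of
the sum, by `2 + 2 cosh d = 4 cosh² (d / 2)`. -/
theorem exists_midpoint (a b : HypThree) : ∃ n : HypThree, ∀ o : HypThree,
    2 * Real.cosh (dist a b / 2) * Real.cosh (dist n o) =
      Real.cosh (dist a o) + Real.cosh (dist b o) := by
  set K := 2 * Real.cosh (dist a b / 2) with hK
  have hK0 : 0 < K := by have := Real.cosh_pos (dist a b / 2); positivity
  have hK2 : K ^ 2 = 2 + 2 * Real.cosh (dist a b) := by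
    have := Real.cosh_two_mul (dist a b / 2)
    rw [mul_div_cancel₀ _ two_ne_zero] at this
    have h2 := Real.cosh_sq (dist a b / 2)
    rw [hK]
    linarith
  rw [cosh_dist] at hK2
  obtain ⟨n, n0, n1, n2, n3⟩ := exists_y (x0 := (a.y0 + b.y0) / K) (x1 := (a.y1 + b.y1) / K)
    (x2 := (a.y2 + b.y2) / K) (x3 := (a.y3 + b.y3) / K)
    (div_pos (add_pos a.y0_pos b.y0_pos) hK0) (by
      field_simp
      linear_combination a.y_sq + b.y_sq - hK2)
  refine ⟨n, fun o => ?_⟩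
  rw [cosh_dist, cosh_dist, cosh_dist, n0, n1, n2, n3]
  field_simp
  ring

/-- Interior points of a geodesic segment are determined by their distances to the ends. -/
theorem eq_of_dist_le {o m a b : HypThree} {s t : ℝ} (hm : t + s ≤ dist o m)
    (ha : dist a o ≤ t) (ha' : dist a m ≤ s) (hb : dist b o ≤ t) (hb' : dist b m ≤ s) : a = b := by
  by_contra hne
  -- If `a ≠ b`, the midpoint is strictly closer than `t` to `o` and than `s` to `m`, contradicting
  -- the triangle inequality.
  obtain ⟨n, hn⟩ := exists_midpoint a b
  have hK : 1 < Real.cosh (dist a b / 2) := by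
    rw [Real.one_lt_cosh]
    have := dist_pos.2 hne
    positivity
  have lt_of : ∀ {u : HypThree} {v : ℝ}, dist a u ≤ v → dist b u ≤ v → dist n u < v := by
    intro u v h1 h2
    have hv : 0 ≤ v := dist_nonneg.trans h1
    have e := hn u
    have h1' : Real.cosh (dist a u) ≤ Real.cosh v := by
      rwa [Real.cosh_le_cosh, abs_of_nonneg dist_nonneg, abs_of_nonneg hv]
    have h2' : Real.cosh (dist b u) ≤ Real.cosh v := by
      rwa [Real.cosh_le_cosh, abs_of_nonneg dist_nonneg, abs_of_nonneg hv]
    have h3 : Real.cosh (dist n u) < Real.cosh v := by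
      have := Real.cosh_pos (dist n u)
      nlinarith
    rwa [Real.cosh_lt_cosh, abs_of_nonneg dist_nonneg, abs_of_nonneg hv] at h3
  have h1 := lt_of ha hb
  have h2 := lt_of ha' hb'
  have h3 := dist_triangle o n m
  rw [dist_comm o n] at h3
  linarith

/-- The point reflection of `a` in `p` is `2 C p - a` in the hyperboloid, with `C = cosh (dist a
p)`. -/
theorem exists_antipode (p a : HypThree) : ∃ b : HypThree, dist b p = dist a p ∧
    dist a b = 2 * dist a p := by
  have hC := cosh_dist a p
  set C := Real.cosh (dist a p) with hCdef
  have hC1 : 1 ≤ C := Real.one_le_cosh _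
  have hp := p.y_sq
  have ha := a.y_sq
  obtain ⟨b0, hb0⟩ : ∃ b0, b0 = 2 * C * p.y0 - a.y0 := ⟨_, rfl⟩
  obtain ⟨b1, hb1⟩ : ∃ b1, b1 = 2 * C * p.y1 - a.y1 := ⟨_, rfl⟩
  obtain ⟨b2, hb2⟩ : ∃ b2, b2 = 2 * C * p.y2 - a.y2 := ⟨_, rfl⟩
  obtain ⟨b3, hb3⟩ : ∃ b3, b3 = 2 * C * p.y3 - a.y3 := ⟨_, rfl⟩
  have hbb : b0 ^ 2 - b1 ^ 2 - b2 ^ 2 - b3 ^ 2 = 1 := by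
    rw [hb0, hb1, hb2, hb3]
    linear_combination 4 * C ^ 2 * hp + ha + 4 * C * hC
  have hbp : b0 * p.y0 - b1 * p.y1 - b2 * p.y2 - b3 * p.y3 = C := by
    rw [hb0, hb1, hb2, hb3]
    linear_combination 2 * C * hp + hC
  -- On the lower sheet the Minkowski product with `p` would be nonpositive by Cauchy–Schwarz, but
  -- it equals `C ≥ 1`.
  have hpos : 0 < b0 := by
    by_contra hneg
    rw [not_lt] at hneg
    have hp0 := p.y0_pos
    have h1 : (b1 * p.y1 + b2 * p.y2 + b3 * p.y3) ^ 2 ≤ (b0 * p.y0) ^ 2 := by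
      have cs : (b1 * p.y1 + b2 * p.y2 + b3 * p.y3) ^ 2 ≤
          (b1 ^ 2 + b2 ^ 2 + b3 ^ 2) * (p.y1 ^ 2 + p.y2 ^ 2 + p.y3 ^ 2) := by
        nlinarith [sq_nonneg (b1 * p.y2 - b2 * p.y1), sq_nonneg (b1 * p.y3 - b3 * p.y1),
          sq_nonneg (b2 * p.y3 - b3 * p.y2)]
      have e1 : b1 ^ 2 + b2 ^ 2 + b3 ^ 2 ≤ b0 ^ 2 := by linarith
      have e2 : p.y1 ^ 2 + p.y2 ^ 2 + p.y3 ^ 2 ≤ p.y0 ^ 2 := by linarith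
      rw [mul_pow]
      exact cs.trans (mul_le_mul e1 e2 (by positivity) (by positivity))
    have h2 := abs_le.1 (sq_le_sq.1 h1)
    rw [abs_of_nonpos (mul_nonpos_of_nonpos_of_nonneg hneg hp0.le)] at h2
    linarith [h2.1]
  obtain ⟨b, e0, e1, e2, e3⟩ := exists_y hpos hbb
  refine ⟨b, ?_, ?_⟩
  · refine Real.cosh_injOn dist_nonneg dist_nonneg ?_
    rw [← hCdef, cosh_dist, e0, e1, e2, e3, hbp]
  · refine Real.cosh_injOn dist_nonneg (by simp : (0 : ℝ) ≤ 2 * dist a p) ?_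
    rw [cosh_dist, e0, e1, e2, e3, hb0, hb1, hb2, hb3, Real.cosh_two_mul, ← hCdef]
    have := Real.cosh_sq (dist a p)
    rw [← hCdef] at this
    linear_combination (-2 * C) * hC - ha + this

theorem exists_segment (p q : HypThree) (h : 0 < dist p q) : ∃ γ : ℝ → HypThree,
    (∀ s t, s ∈ Set.Icc 0 (dist p q) → t ∈ Set.Icc 0 (dist p q) → dist (γ s) (γ t) = |s - t|) ∧
      γ 0 = p ∧ γ (dist p q) = q := by
  obtain ⟨Ψ, h1, -, -, h4⟩ := exists_chart ⟨0, 0, 0, le_rfl⟩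
  obtain ⟨γ, g1, g2, g3⟩ := Cyl.exists_segment_cos (Ψ p) (Ψ q) (by rwa [h1])
  rw [h1] at g1 g3
  choose β hβ using fun t => h4 (γ t)
  refine ⟨β, fun s t hs ht => ?_, ?_, ?_⟩
  · rw [← h1, Cyl.adist_cos_congr (hβ s), Cyl.adist_comm angleFun_cos,
      Cyl.adist_cos_congr (hβ t), Cyl.adist_comm angleFun_cos, g1 s t hs ht]
  · rw [← dist_eq_zero, ← h1, Cyl.adist_cos_congr (hβ 0), Cyl.adist_comm angleFun_cos, g2]
  · rw [← dist_eq_zero, ← h1, Cyl.adist_cos_congr (hβ _), g3]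

end HypThree

/-! ### Quotient models: embedded balls and the obstruction to larger ones -/

/-- A locally `1`-Lipschitz path does not move further than its parameter. -/
theorem dist_le_of_locally_dist_le {X : Type*} (d : X → X → ℝ) (hself : ∀ x, d x x = 0)
    (htri : ∀ x y z, d x z ≤ d x y + d y z) (hcomm : ∀ x y, d x y = d y x) (φ : ℝ → X) {a b : ℝ}
    (hab : a ≤ b) (h : ∀ s ∈ Set.Icc a b, ∃ δ > 0, ∀ t ∈ Set.Icc a b, |t - s| < δ →
      d (φ t) (φ s) ≤ |t - s|) : d (φ a) (φ b) ≤ b - a := by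
  -- Continuous induction along `[a, b]`. `X` carries no topology, so closedness comes from the
  -- local bound and the triangle inequality.
  have hclosed : IsClosed ({t | d (φ a) (φ t) ≤ t - a} ∩ Set.Icc a b) := by
    refine isClosed_of_closure_subset fun t ht => ?_
    have ht' : t ∈ Set.Icc a b := by
      have := closure_mono Set.inter_subset_right ht
      rwa [isClosed_Icc.closure_eq] at this
    refine ⟨?_, ht'⟩
    show d (φ a) (φ t) ≤ t - a
    refine le_of_forall_pos_le_add fun e he => ?_
    obtain ⟨δ, hδ, hloc⟩ := h t ht'
    obtain ⟨u, ⟨hu, hu'⟩, hut⟩ := Metric.mem_closure_iff.1 ht (min δ (e / 2)) (by positivity)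
    rw [dist_comm, Real.dist_eq, lt_min_iff] at hut
    have h1 := hloc u hu' hut.1
    have h2 := htri (φ a) (φ u) (φ t)
    have h3 : d (φ a) (φ u) ≤ u - a := hu
    have h4 := le_abs_self (u - t)
    linarith
  have hsub := hclosed.Icc_subset_of_forall_mem_nhdsWithin (by simp [hself]) (fun s hs => ?_)
  · exact hsub ⟨hab, le_rfl⟩
  · obtain ⟨δ, hδ, hloc⟩ := h s (Set.Ico_subset_Icc_self hs.2)
    have : Set.Ioo s (min (s + δ) b) ∈ nhdsWithin s (Set.Ioi s) :=
      Ioo_mem_nhdsGT (lt_min (by linarith) hs.2.2)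
    filter_upwards [this] with t ht
    have ht1 := ht.1
    obtain ⟨ht2, ht3⟩ := lt_min_iff.1 ht.2
    have h1 := hloc t ⟨hs.2.1.trans ht1.le, ht3.le⟩ (by rw [abs_lt]; constructor <;> linarith)
    rw [abs_of_pos (by linarith), hcomm] at h1
    have h2 := htri (φ a) (φ s) (φ t)
    have h3 : d (φ a) (φ s) ≤ s - a := hs.1
    show d (φ a) (φ t) ≤ t - a
    linarith

namespace ModelTorus

open Cyl

/-- The image in the model solid torus of a point in cylindrical coordinates. -/
noncomputable def ofCyl (α l τ : ℝ) (c : Cyl) : ModelTorus α l τ := proj (SeparationQuotient.mk c)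

/-- The angle function `k` and the group `S` describe the metric of the model solid torus as the
quotient metric of `adist k` by `S`. -/
structure IsQuotientModel (α l τ : ℝ) (k : ℝ → ℝ) (S : AddSubgroup ℂ) : Prop where
  angle : AngleFun k
  triangle : ∀ o p q, adist k o q ≤ adist k o p + adist k p q
  dist_le : ∀ c c', ∀ z ∈ S, dist (ofCyl α l τ c) (ofCyl α l τ c') ≤ adist k c (c'.shift z)
  exists_lt : ∀ c c' d, dist (ofCyl α l τ c) (ofCyl α l τ c') < d →
    ∃ z ∈ S, adist k c (c'.shift z) < d
  eq_of_adist : ∀ c c', adist k c c' = 0 → ofCyl α l τ c = ofCyl α l τ c'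
  shift_eq : ∀ c, ∀ z ∈ S, ofCyl α l τ (c.shift z) = ofCyl α l τ c
  exists_of_eq : ∀ c c', ofCyl α l τ c = ofCyl α l τ c' → ∃ z ∈ S, adist k c (c'.shift z) = 0

theorem exists_ofCyl {α l τ : ℝ} (x : ModelTorus α l τ) : ∃ c, ofCyl α l τ c = x := by
  obtain ⟨⟨c⟩, rfl⟩ := Quotient.exists_rep x
  exact ⟨c, rfl⟩

namespace IsQuotientModel

variable {α l τ : ℝ} {k : ℝ → ℝ} {S : AddSubgroup ℂ}

theorem congr (M : IsQuotientModel α l τ k S) {p q : Cyl} (h : adist k p q = 0) (c : Cyl) :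
    adist k p c = adist k q c := by
  have h1 := M.triangle p q c
  have h2 := M.triangle q p c
  rw [adist_comm M.angle q p] at h2
  linarith

theorem nonneg (M : IsQuotientModel α l τ k S) (x y : ModelTorus α l τ) : 0 ≤ dist x y := by
  obtain ⟨c, rfl⟩ := exists_ofCyl x
  obtain ⟨c', rfl⟩ := exists_ofCyl y
  by_contra h
  obtain ⟨z, -, hz⟩ := M.exists_lt c c' 0 (not_le.1 h)
  exact hz.not_ge (adist_nonneg M.angle _ _)

theorem self (M : IsQuotientModel α l τ k S) (x : ModelTorus α l τ) : dist x x = 0 := by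
  refine le_antisymm ?_ (M.nonneg x x)
  obtain ⟨c, rfl⟩ := exists_ofCyl x
  simpa [shift_zero, adist_self M.angle] using M.dist_le c c 0 S.zero_mem

theorem comm (M : IsQuotientModel α l τ k S) (x y : ModelTorus α l τ) : dist x y = dist y x := by
  have key : ∀ x y : ModelTorus α l τ, dist x y ≤ dist y x := fun x y => by
    obtain ⟨c, rfl⟩ := exists_ofCyl x
    obtain ⟨c', rfl⟩ := exists_ofCyl y
    refine le_of_forall_gt fun d hd => ?_
    obtain ⟨z, hz, hlt⟩ := M.exists_lt c' c d hd
    refine (M.dist_le c c' (-z) (S.neg_mem hz)).trans_lt ?_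
    rwa [← adist_shift z, shift_shift, add_neg_cancel, shift_zero, adist_comm M.angle]
  exact le_antisymm (key x y) (key y x)

theorem tri (M : IsQuotientModel α l τ k S) (x y w : ModelTorus α l τ) :
    dist x w ≤ dist x y + dist y w := by
  obtain ⟨a, rfl⟩ := exists_ofCyl x
  obtain ⟨b, rfl⟩ := exists_ofCyl y
  obtain ⟨c, rfl⟩ := exists_ofCyl w
  refine le_of_forall_pos_le_add fun e he => ?_
  obtain ⟨z, hz, h1⟩ := M.exists_lt a b _ (lt_add_of_pos_right _ (half_pos he))
  obtain ⟨v, hv, h2⟩ := M.exists_lt b c _ (lt_add_of_pos_right _ (half_pos he))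
  have h3 := M.dist_le a c (z + v) (S.add_mem hz hv)
  have h4 := M.triangle a (b.shift z) (c.shift (z + v))
  rw [← shift_shift, adist_shift] at h4
  rw [← shift_shift] at h3
  linarith

/-- Two lifts in the `R`-ball about `x` that a nonzero `z` brought too close would give a
displacement of `x` below `2 * R`; this is `key`. Near each point the quotient distance is therefore
attained by `z = 0`. -/
theorem ballIsometric (M : IsQuotientModel α l τ k S) {x : Cyl} {R : ℝ}
    (hR : ∀ z ∈ S, z ≠ 0 → 2 * R ≤ adist k x (x.shift z)) {Ψ : HypThree → Cyl}
    (hbase : adist k (Ψ HypThree.base) x = 0)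
    (hiso : ∀ a ∈ HypThree.baseBall R, ∀ b ∈ HypThree.baseBall R,
      adist k (Ψ a) (Ψ b) = dist a b)
    (hsurj : ∀ c, adist k c x < R → ∃ p ∈ HypThree.baseBall R, adist k (Ψ p) c = 0) :
    BallIsometric (ofCyl α l τ x) R := by
  have hk := M.angle
  have hx : ∀ a ∈ HypThree.baseBall R, adist k (Ψ a) x = dist a HypThree.base := by
    intro a ha
    have hb : HypThree.base ∈ HypThree.baseBall R := by
      have : dist a HypThree.base < R := ha
      show dist HypThree.base HypThree.base < R
      rw [dist_self]
      exact dist_nonneg.trans_lt this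
    rw [← hiso a ha _ hb, adist_comm hk, ← M.congr hbase, adist_comm hk]
  have key : ∀ a ∈ HypThree.baseBall R, ∀ b ∈ HypThree.baseBall R, ∀ z ∈ S,
      adist k (Ψ a) ((Ψ b).shift z) < 2 * R - dist a HypThree.base - dist b HypThree.base →
      z = 0 := by
    intro a ha b hb z hz h
    by_contra hne
    have h1 := hR z hz hne
    have h2 := M.triangle x (Ψ a) (x.shift z)
    have h3 := M.triangle (Ψ a) ((Ψ b).shift z) (x.shift z)
    rw [adist_shift, hx b hb] at h3
    rw [adist_comm hk x (Ψ a), hx a ha] at h2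
    linarith
  have hlt : ∀ a ∈ HypThree.baseBall R, dist a HypThree.base < R := fun a ha => ha
  have hle : ∀ a ∈ HypThree.baseBall R, ∀ b ∈ HypThree.baseBall R,
      dist (ofCyl α l τ (Ψ a)) (ofCyl α l τ (Ψ b)) ≤ dist a b := fun a ha b hb => by
    simpa [shift_zero, hiso a ha b hb] using M.dist_le (Ψ a) (Ψ b) 0 S.zero_mem
  refine ⟨fun p => ofCyl α l τ (Ψ p), M.eq_of_adist _ _ hbase, ⟨fun a ha => ?_, ?_, ?_⟩, ?_⟩
  · have := M.dist_le (Ψ a) x 0 S.zero_mem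
    rw [shift_zero, hx a ha] at this
    exact this.trans_lt ha
  · intro a ha b hb hab
    obtain ⟨z, hz, h0⟩ := M.exists_of_eq _ _ hab
    have hz0 := key a ha b hb z hz (by rw [h0]; linarith [hlt a ha, hlt b hb])
    rw [hz0, shift_zero, hiso a ha b hb] at h0
    exact dist_eq_zero.1 h0
  · intro y hy
    obtain ⟨c, rfl⟩ := exists_ofCyl y
    obtain ⟨z, hz, h⟩ := M.exists_lt c x R hy
    obtain ⟨p, hp, hpc⟩ := hsurj (c.shift (-z)) (by
      rwa [← adist_shift z, shift_shift, add_neg_cancel, shift_zero])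
    exact ⟨p, hp, (M.eq_of_adist _ _ hpc).trans (M.shift_eq c _ (S.neg_mem hz))⟩
  · intro p hp
    have hp' := hlt p hp
    -- With this `δ`, points `a, b` within `δ` of `p` satisfy `dist a b < R - dist p base`, which is
    -- below the bound required by `key`.
    refine ⟨(R - dist p HypThree.base) / 2, by linarith, fun a ha b hb hab => ?_⟩
    have clos : ∀ a ∈ HypThree.baseBall R,
        dist (ofCyl α l τ (Ψ a)) (ofCyl α l τ (Ψ p)) < (R - dist p HypThree.base) / 2 →
        dist a p < (R - dist p HypThree.base) / 2 := by
      intro a ha h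
      obtain ⟨z, hz, h'⟩ := M.exists_lt _ _ _ h
      have hz0 := key a ha p hp z hz (h'.trans (by linarith [hlt a ha]))
      rwa [hz0, shift_zero, hiso a ha p hp] at h'
    have hab' : dist a p < (R - dist p HypThree.base) / 2 ∧
        dist b p < (R - dist p HypThree.base) / 2 := by
      rcases hab with h | h
      · exact h
      · exact ⟨clos a ha h.1, clos b hb h.2⟩
    refine le_antisymm (hle a ha b hb) ?_
    by_contra h
    obtain ⟨z, hz, h'⟩ := M.exists_lt _ _ _ (not_le.1 h)
    have h1 := dist_triangle a p HypThree.base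
    have h2 := dist_triangle b p HypThree.base
    have h3 := dist_triangle a p b
    rw [dist_comm p b] at h3
    have hz0 := key a ha b hb z hz (h'.trans (by linarith))
    rw [hz0, shift_zero, hiso a ha b hb] at h'
    exact lt_irrefl _ h'

/-- The ball about `x` is not embedded beyond half the shortest displacement. -/
theorem le_of_ballIsometric (M : IsQuotientModel α l τ k S) {x : Cyl} {R ρ η : ℝ} (hR0 : 0 < R)
    {z₀ : ℂ} (hz₀ : z₀ ∈ S) (hR : ∀ z ∈ S, z ≠ 0 → 2 * R ≤ adist k x (x.shift z)) {γ : ℝ → Cyl}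
    (hγ : IsSegment k x (x.shift z₀) (2 * R) γ) (hη : 0 < η)
    (hm : ∀ z ∈ S, z ≠ 0 → η ≤ adist k (γ R) ((γ R).shift z))
    (hball : BallIsometric (ofCyl α l τ x) ρ) : ρ ≤ R := by
  have hk := M.angle
  by_contra hρ
  rw [not_le] at hρ
  obtain ⟨f, hfbase, hbij, hloc⟩ := hball
  obtain ⟨hseg, hγ0, hγ1⟩ := hγ
  set P : ℝ → ModelTorus α l τ := fun t => ofCyl α l τ (γ t) with hP
  have m0 : (0 : ℝ) ∈ Set.Icc 0 (2 * R) := ⟨le_rfl, by linarith⟩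
  have m1 : 2 * R ∈ Set.Icc 0 (2 * R) := ⟨by linarith, le_rfl⟩
  have mR : R ∈ Set.Icc 0 (2 * R) := ⟨hR0.le, by linarith⟩
  have hPle : ∀ s t, s ∈ Set.Icc 0 (2 * R) → t ∈ Set.Icc 0 (2 * R) → dist (P s) (P t) ≤ |s - t| :=
    fun s t hs ht => by
      have := M.dist_le (γ s) (γ t) 0 S.zero_mem
      rwa [shift_zero, hseg s t hs ht] at this
  have hP0 : P 0 = ofCyl α l τ x := (M.eq_of_adist _ _ hγ0).symm
  have hP1 : P (2 * R) = ofCyl α l τ x := (M.eq_of_adist _ _ hγ1).trans (M.shift_eq x z₀ hz₀)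
  have hPball : ∀ t ∈ Set.Icc 0 (2 * R), P t ∈ openBall (ofCyl α l τ x) ρ := by
    intro t ht
    show dist (P t) (ofCyl α l τ x) < ρ
    rcases le_total t R with h | h
    · have := hPle t 0 ht m0
      rw [hP0, sub_zero, abs_of_nonneg ht.1] at this
      linarith
    · have := hPle t (2 * R) ht m1
      rw [hP1, abs_of_nonpos (by linarith [ht.2])] at this
      linarith
  have hbase : HypThree.base ∈ HypThree.baseBall ρ := by
    show dist HypThree.base HypThree.base < ρ
    rw [dist_self]; linarith
  -- Pull the loop `P` back through `f` to a loop `c` at the base point; it is locally, hence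
  -- globally, `1`-Lipschitz.
  have hex : ∀ t, ∃ c, t ∈ Set.Icc 0 (2 * R) → c ∈ HypThree.baseBall ρ ∧ f c = P t := by
    intro t
    by_cases ht : t ∈ Set.Icc 0 (2 * R)
    · obtain ⟨c, hc, hc'⟩ := hbij.surjOn (hPball t ht)
      exact ⟨c, fun _ => ⟨hc, hc'⟩⟩
    · exact ⟨HypThree.base, fun h => absurd h ht⟩
  choose c hc using hex
  have hc0 : c 0 = HypThree.base :=
    hbij.injOn (hc 0 m0).1 hbase (by rw [(hc 0 m0).2, hP0, hfbase])
  have hc1 : c (2 * R) = HypThree.base :=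
    hbij.injOn (hc _ m1).1 hbase (by rw [(hc _ m1).2, hP1, hfbase])
  have hchain : ∀ s t, s ∈ Set.Icc 0 (2 * R) → t ∈ Set.Icc 0 (2 * R) → s ≤ t →
      dist (c s) (c t) ≤ t - s := by
    intro s t hs ht hst
    refine dist_le_of_locally_dist_le dist dist_self dist_triangle dist_comm c hst
      fun u hu => ?_
    have hu' : u ∈ Set.Icc 0 (2 * R) := ⟨hs.1.trans hu.1, hu.2.trans ht.2⟩
    obtain ⟨δ, hδ, h⟩ := hloc (c u) (hc u hu').1
    refine ⟨δ, hδ, fun v hv hvu => ?_⟩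
    have hv' : v ∈ Set.Icc 0 (2 * R) := ⟨hs.1.trans hv.1, hv.2.trans ht.2⟩
    have hle := hPle v u hv' hu'
    have := h (c v) (hc v hv').1 (c u) (hc u hu').1 (Or.inr (by
      rw [(hc v hv').2, (hc u hu').2, M.self]
      exact ⟨hle.trans_lt hvu, hδ⟩))
    rwa [← this, (hc v hv').2, (hc u hu').2]
  -- The hyperbolic segment from the base point to `c R` is mapped by `f` to a locally `1`-Lipschitz
  -- path from `x` to `P R`, and these are at distance at least `R`.
  have hmid : R ≤ dist HypThree.base (c R) := by
    have h1 : R ≤ dist (ofCyl α l τ x) (P R) := by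
      by_contra hlt
      rw [M.comm, not_le] at hlt
      obtain ⟨z, hz, h⟩ := M.exists_lt _ _ _ hlt
      have h0 : adist k x (γ R) = R := by
        rw [M.congr hγ0, hseg 0 R m0 mR, zero_sub, abs_neg, abs_of_pos hR0]
      by_cases hz0 : z = 0
      · rw [hz0, shift_zero, adist_comm hk, h0] at h
        exact lt_irrefl _ h
      · have h2 := hR z hz hz0
        have h3 := M.triangle x (γ R) (x.shift z)
        linarith
    rcases (dist_nonneg (x := HypThree.base) (y := c R)).eq_or_lt with h0 | h0
    · have : c R = HypThree.base := (dist_eq_zero.1 h0.symm).symm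
      rw [← (hc R mR).2, this, hfbase, M.self] at h1
      linarith
    · obtain ⟨β, hβ, hβ0, hβ1⟩ := HypThree.exists_segment _ _ h0
      set D := dist HypThree.base (c R)
      have n0 : (0 : ℝ) ∈ Set.Icc 0 D := ⟨le_rfl, h0.le⟩
      have hcR : D < ρ := by
        have : dist (c R) HypThree.base < ρ := (hc R mR).1
        rwa [dist_comm] at this
      have hβball : ∀ t ∈ Set.Icc 0 D, β t ∈ HypThree.baseBall ρ := fun t ht => by
        show dist (β t) HypThree.base < ρ
        rw [← hβ0, hβ t 0 ht n0, sub_zero, abs_of_nonneg ht.1]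
        exact ht.2.trans_lt hcR
      have := dist_le_of_locally_dist_le dist M.self M.tri M.comm (fun t => f (β t)) h0.le
        fun u hu => ?_
      · simp only [hβ0, hβ1, hfbase, (hc R mR).2, sub_zero] at this
        exact h1.trans this
      · obtain ⟨δ, hδ, h⟩ := hloc (β u) (hβball u hu)
        refine ⟨δ, hδ, fun v hv hvu => ?_⟩
        rw [h (β v) (hβball v hv) (β u) (hβball u hu) (Or.inl ?_), hβ v u hv hu]
        rw [hβ v u hv hu, dist_self]
        exact ⟨hvu, hδ⟩
  -- Both `c (R - s)` and `c (R + s)` lie within `R - s` of the base point and `s` of `c R`, so they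
  -- coincide. The translation `z` then identifying `γ (R ± s)` is either zero, which unit speed
  -- forbids, or moves `γ R` by at most `2 * s < η`.
  obtain ⟨s, hs0, hs, hsη⟩ : ∃ s, 0 < s ∧ s < R ∧ 2 * s < η :=
    ⟨min R η / 3, by positivity, by linarith [min_le_left R η], by linarith [min_le_right R η]⟩
  have ma : R - s ∈ Set.Icc 0 (2 * R) := ⟨by linarith, by linarith⟩
  have mb : R + s ∈ Set.Icc 0 (2 * R) := ⟨by linarith, by linarith⟩
  have a1 := hchain 0 (R - s) m0 ma ma.1
  have a2 := hchain (R - s) R ma mR (by linarith)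
  have b1 := hchain (R + s) (2 * R) mb m1 mb.2
  have b2 := hchain R (R + s) mR mb (by linarith)
  rw [hc0, dist_comm] at a1
  rw [hc1] at b1
  rw [dist_comm] at b2
  have heq := HypThree.eq_of_dist_le (o := HypThree.base) (m := c R) (a := c (R - s))
    (b := c (R + s)) (s := s) (t := R - s) (by linarith) (by linarith) (by linarith) (by linarith)
    (by linarith)
  have hPeq : P (R - s) = P (R + s) := by rw [← (hc _ ma).2, ← (hc _ mb).2, heq]
  obtain ⟨z, hz, h0⟩ := M.exists_of_eq _ _ hPeq
  have e1 := hseg (R - s) R ma mR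
  have e2 := hseg (R + s) R mb mR
  rw [abs_of_neg (by linarith)] at e1
  rw [abs_of_pos (by linarith)] at e2
  by_cases hz0 : z = 0
  · rw [hz0, shift_zero, hseg _ _ ma mb, abs_eq_zero] at h0
    linarith
  · have h1 := hm z hz hz0
    have h2 := M.triangle (γ R) (γ (R - s)) ((γ R).shift z)
    have h3 := M.triangle (γ (R - s)) ((γ (R + s)).shift z) ((γ R).shift z)
    rw [adist_shift] at h3
    rw [adist_comm hk (γ R) (γ (R - s))] at h2
    linarith

end IsQuotientModel

end ModelTorus

/-! ### The model torus as a quotient, its core, and the cone singularity -/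

namespace Cyl

theorem abs_sub_r_le_adist {k : ℝ → ℝ} (hk : AngleFun k) (p q : Cyl) :
    |p.r - q.r| ≤ adist k p q := by
  have h := cosh_sub_le_chd hk p q
  rwa [← cosh_adist hk, Real.cosh_le_cosh, abs_of_nonneg (adist_nonneg hk p q)] at h

end Cyl

namespace ModelTorus

open Cyl

variable {α l τ : ℝ}

theorem mem_deckGroup {z : ℂ} :
    z ∈ deckGroup α l τ ↔ ∃ n m : ℤ, z = ⟨n * l, n * τ + m * α⟩ := by
  rw [deckGroup, AddSubgroup.mem_closure_pair]
  constructor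
  · rintro ⟨m, n, rfl⟩
    refine ⟨n, m, ?_⟩
    apply Complex.ext <;> simp
    ring
  · rintro ⟨n, m, rfl⟩
    refine ⟨m, n, ?_⟩
    apply Complex.ext <;> simp
    ring

theorem ofCyl_eq_iff {c c' : Cyl} :
    ofCyl α l τ c = ofCyl α l τ c' ↔ ∃ z ∈ deckGroup α l τ, dist c (c'.shift z) = 0 := by
  rw [ofCyl, ofCyl, proj, proj, Quotient.eq, AddAction.orbitRel_apply, AddAction.mem_orbit_iff]
  constructor
  · rintro ⟨z, hz⟩
    refine ⟨z, z.2, ?_⟩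
    have h : (SeparationQuotient.mk (c'.shift z) : HHat) = SeparationQuotient.mk c := hz
    rw [← SeparationQuotient.dist_mk, h, dist_self]
  · rintro ⟨z, hz, h⟩
    refine ⟨⟨z, hz⟩, ?_⟩
    show (SeparationQuotient.mk (c'.shift z) : HHat) = SeparationQuotient.mk c
    rw [← dist_eq_zero, SeparationQuotient.dist_mk, dist_comm, h]

theorem ofCyl_shift (c : Cyl) {z : ℂ} (hz : z ∈ deckGroup α l τ) :
    ofCyl α l τ (c.shift z) = ofCyl α l τ c :=
  ofCyl_eq_iff.2 ⟨z, hz, dist_self _⟩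

theorem bddBelow_dist (x y : ModelTorus α l τ) :
    BddBelow {d | ∃ p q : HHat, proj p = x ∧ proj q = y ∧ d = dist p q} :=
  ⟨0, by rintro _ ⟨p, q, -, -, rfl⟩; exact dist_nonneg⟩

theorem dist_ofCyl_le (c c' : Cyl) : dist (ofCyl α l τ c) (ofCyl α l τ c') ≤ dist c c' :=
  csInf_le (bddBelow_dist _ _) ⟨_, _, rfl, rfl, (SeparationQuotient.dist_mk c c').symm⟩

theorem exists_of_dist_lt {c c' : Cyl} {d : ℝ}
    (h : dist (ofCyl α l τ c) (ofCyl α l τ c') < d) :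
    ∃ z ∈ deckGroup α l τ, dist c (c'.shift z) < d := by
  obtain ⟨_, ⟨⟨p⟩, ⟨q⟩, hp, hq, rfl⟩, hlt⟩ := exists_lt_of_csInf_lt
    (s := {d | ∃ p q : HHat, proj p = ofCyl α l τ c ∧ proj q = ofCyl α l τ c' ∧ d = dist p q})
    ⟨_, _, _, rfl, rfl, rfl⟩ h
  obtain ⟨z, hz, h1⟩ := ofCyl_eq_iff.1 (show ofCyl α l τ c = ofCyl α l τ p from hp.symm)
  obtain ⟨w, hw, h2⟩ := ofCyl_eq_iff.1 (show ofCyl α l τ q = ofCyl α l τ c' from hq)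
  refine ⟨z + w, add_mem hz hw, ?_⟩
  have h3 : dist p q < d := by rwa [← SeparationQuotient.dist_mk]
  have h4 := dist_triangle4 c (p.shift z) (q.shift z) (c'.shift (z + w))
  rw [← shift_shift, (isometry_shift z).dist_eq, (isometry_shift z).dist_eq, h1, h2] at h4
  rw [← shift_shift]
  linarith

theorem isQuotientModel_cutCos : IsQuotientModel α l τ cutCos (deckGroup α l τ) where
  angle := angleFun_cutCos
  triangle o p q := by
    simp only [← dist_eq_adist]
    exact dist_triangle o p q
  dist_le c c' z hz := by
    rw [← dist_eq_adist, ← ofCyl_shift c' hz]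
    exact dist_ofCyl_le _ _
  exists_lt c c' d h := by
    simp only [← dist_eq_adist]
    exact exists_of_dist_lt h
  eq_of_adist c c' h := ofCyl_eq_iff.2 ⟨0, zero_mem _, by rwa [shift_zero, dist_eq_adist]⟩
  shift_eq c z hz := ofCyl_shift c hz
  exists_of_eq c c' h := by
    simp only [← dist_eq_adist]
    exact ofCyl_eq_iff.1 h

theorem turn_mem (m : ℤ) : (⟨0, m * (2 * Real.pi)⟩ : ℂ) ∈ deckGroup (2 * Real.pi) l τ :=
  mem_deckGroup.2 ⟨0, m, by simp⟩

theorem zmultiples_le (z : ℂ) (hz : z ∈ AddSubgroup.zmultiples (⟨l, τ⟩ : ℂ)) :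
    z ∈ deckGroup α l τ :=
  (AddSubgroup.zmultiples_le_of_mem (AddSubgroup.subset_closure (by simp))) hz

theorem exists_adist_cos_le {c c' : Cyl} {z : ℂ} (hz : z ∈ deckGroup (2 * Real.pi) l τ) :
    ∃ w ∈ AddSubgroup.zmultiples (⟨l, τ⟩ : ℂ),
      adist Real.cos c (c'.shift w) ≤ dist c (c'.shift z) := by
  obtain ⟨n, m, rfl⟩ := mem_deckGroup.1 hz
  refine ⟨n • ⟨l, τ⟩, ⟨n, rfl⟩, ?_⟩
  have e : c'.shift ⟨n * l, n * τ + m * (2 * Real.pi)⟩ =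
      (c'.shift (n • ⟨l, τ⟩)).shift ⟨0, m * (2 * Real.pi)⟩ := by
    rw [shift_shift]
    congr 1
    apply Complex.ext <;> simp
    ring
  rw [e]
  refine le_trans (le_of_eq ?_) (adist_cos_le_dist _ _)
  rw [adist, adist, chd_cos_turn]

/-- When `α = 2π` the elliptic part of the deck group consists of whole turns, which the cosine does
not see. -/
theorem isQuotientModel_cos :
    IsQuotientModel (2 * Real.pi) l τ Real.cos (AddSubgroup.zmultiples ⟨l, τ⟩) where
  angle := angleFun_cos
  triangle := adist_cos_triangle
  dist_le c c' z hz := by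
    obtain ⟨m, hm⟩ := exists_turn c (c'.shift z)
    rw [← hm, ← ofCyl_shift c' (zmultiples_le z hz), ← ofCyl_shift (c'.shift z) (turn_mem m)]
    exact dist_ofCyl_le _ _
  exists_lt c c' d h := by
    obtain ⟨z, hz, hlt⟩ := exists_of_dist_lt h
    obtain ⟨w, hw, hle⟩ := exists_adist_cos_le (c := c) (c' := c') hz
    exact ⟨w, hw, hle.trans_lt hlt⟩
  eq_of_adist c c' h := by
    obtain ⟨m, hm⟩ := exists_turn c c'
    exact ofCyl_eq_iff.2 ⟨_, turn_mem m, hm.trans h⟩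
  shift_eq c z hz := ofCyl_shift c (zmultiples_le z hz)
  exists_of_eq c c' h := by
    obtain ⟨z, hz, h0⟩ := ofCyl_eq_iff.1 h
    obtain ⟨w, hw, hle⟩ := exists_adist_cos_le (c := c) (c' := c') hz
    exact ⟨w, hw, le_antisymm (hle.trans h0.le) (adist_nonneg angleFun_cos _ _)⟩

theorem abs_sub_r_le_dist (c c' : Cyl) : |c.r - c'.r| ≤ dist (ofCyl α l τ c) (ofCyl α l τ c') := by
  refine le_of_forall_gt fun d hd => ?_
  obtain ⟨z, -, h⟩ := exists_of_dist_lt hd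
  rw [dist_eq_adist] at h
  exact (abs_sub_r_le_adist angleFun_cutCos c (c'.shift z)).trans_lt h

theorem ofCyl_mem_core {c : Cyl} : ofCyl α l τ c ∈ core α l τ ↔ c.r = 0 := by
  constructor
  · rintro ⟨_, ⟨ζ, θ, rfl⟩, h⟩
    have h' : ofCyl α l τ ⟨0, ζ, θ, le_rfl⟩ = ofCyl α l τ c := h
    have := abs_sub_r_le_dist (α := α) (l := l) (τ := τ) ⟨0, ζ, θ, le_rfl⟩ c
    rw [h', isQuotientModel_cutCos.self, zero_sub, abs_neg, abs_nonpos_iff] at this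
    exact this
  · intro h
    refine ⟨_, ⟨c.ζ, c.θ, rfl⟩, ?_⟩
    show ofCyl α l τ ⟨0, c.ζ, c.θ, le_rfl⟩ = ofCyl α l τ c
    congr 1
    cases c
    simp only at h
    simp only [h]

theorem adist_to_axis {k : ℝ → ℝ} (hk : AngleFun k) (c : Cyl) (θ : ℝ) :
    adist k c ⟨0, c.ζ, θ, le_rfl⟩ = c.r := by
  rw [adist_eq_iff hk c.r_nonneg, chd]
  simp

theorem coreDist_ofCyl (c : Cyl) : coreDist (ofCyl α l τ c) = c.r := by
  have hmem : dist (ofCyl α l τ c) (ofCyl α l τ ⟨0, c.ζ, c.θ, le_rfl⟩) ∈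
      {d | ∃ y ∈ core α l τ, d = dist (ofCyl α l τ c) y} :=
    ⟨_, ofCyl_mem_core.2 rfl, rfl⟩
  have hlow : ∀ d ∈ {d | ∃ y ∈ core α l τ, d = dist (ofCyl α l τ c) y}, c.r ≤ d := by
    rintro _ ⟨y, hy, rfl⟩
    obtain ⟨b, rfl⟩ := exists_ofCyl y
    have := abs_sub_r_le_dist (α := α) (l := l) (τ := τ) c b
    rwa [ofCyl_mem_core.1 hy, sub_zero, abs_of_nonneg c.r_nonneg] at this
  refine le_antisymm ((csInf_le ⟨_, hlow⟩ hmem).trans ?_) (le_csInf ⟨_, hmem⟩ hlow)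
  refine (dist_ofCyl_le _ _).trans (le_of_eq ?_)
  rw [dist_eq_adist, adist_to_axis angleFun_cutCos]

/-- No hyperbolic ball contains a point of a singular core. -/
theorem ball_disjoint_core {x : ModelTorus α l τ} {ρ : ℝ} (hα : 0 < α) (hα' : α < 2 * Real.pi)
    (hball : BallIsometric x ρ) {y : Cyl} (hy : y.r = 0)
    (hyx : dist (ofCyl α l τ y) x < ρ) : False := by
  have M := isQuotientModel_cutCos (α := α) (l := l) (τ := τ)
  have hk := angleFun_cutCos
  obtain ⟨f, -, hbij, hloc⟩ := hball
  obtain ⟨p, hp, hpy⟩ := hbij.surjOn hyx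
  have hp' : dist p HypThree.base < ρ := hp
  obtain ⟨δ, hδ, h⟩ := hloc p hp
  rw [hpy] at h
  obtain ⟨s, hs0, hsδ, hsx, hsp⟩ : ∃ s, 0 < s ∧ s < δ ∧ s < ρ - dist (ofCyl α l τ y) x ∧
      s < ρ - dist p HypThree.base := by
    obtain ⟨s, h1, h2⟩ := exists_between (lt_min hδ (lt_min (sub_pos.2 hyx) (sub_pos.2 hp')))
    obtain ⟨h2, h3, h4⟩ := (lt_min_iff.trans (and_congr_right' lt_min_iff)).1 h2
    exact ⟨s, h1, h2, h3, h4⟩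
  set a : Cyl := ⟨s, y.ζ, 0, hs0.le⟩ with ha
  have hay : dist (ofCyl α l τ a) (ofCyl α l τ y) = s := by
    refine le_antisymm ?_ ?_
    · have h1 := M.dist_le a y 0 (zero_mem _)
      have e : y = ⟨0, y.ζ, y.θ, le_rfl⟩ := by
        cases y
        simp only at hy
        simp only [hy]
      rw [shift_zero] at h1
      have h2 := adist_to_axis hk a y.θ
      rw [ha] at h2
      simp only at h2
      rw [← ha, ← e] at h2
      exact h1.trans h2.le
    · have := abs_sub_r_le_dist (α := α) (l := l) (τ := τ) a y
      rwa [hy, sub_zero, abs_of_pos hs0] at this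
  obtain ⟨a', ha', hfa⟩ := hbij.surjOn (show ofCyl α l τ a ∈ openBall x ρ by
    have := M.tri (ofCyl α l τ a) (ofCyl α l τ y) x
    show dist (ofCyl α l τ a) x < ρ
    linarith)
  have hap : dist a' p = s := by
    rw [← h a' ha' p hp (Or.inr (by rw [hfa, hpy, hay, M.self]; exact ⟨hsδ, hδ⟩)), hfa, hpy, hay]
  -- In `ℍ³` the point `a'` has an antipode about `p`, so the torus would contain two points at
  -- distance `s` from `y` and `2 * s` from each other.
  obtain ⟨b', hb1, hb2⟩ := HypThree.exists_antipode p a'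
  rw [hap] at hb1 hb2
  have hb' : b' ∈ HypThree.baseBall ρ := by
    have := dist_triangle b' p HypThree.base
    show dist b' HypThree.base < ρ
    linarith
  have hby : dist (f b') (ofCyl α l τ y) = s := by
    rw [← hpy, h b' hb' p hp (Or.inl (by rw [hb1, dist_self]; exact ⟨hsδ, hδ⟩)), hb1]
  have hab : dist (ofCyl α l τ a) (f b') = 2 * s := by
    rw [← hfa, h a' ha' b' hb' (Or.inl (by rw [hap, hb1]; exact ⟨hsδ, hsδ⟩)), hb2]
  obtain ⟨b, hb⟩ := exists_ofCyl (f b')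
  rw [← hb] at hby hab
  -- About a cone axis of angle `α`, a lift can be rotated to within angle `α / 2 < π`, so the
  -- cosine is at least `-μ` with `μ < 1`. The maximum with `0` keeps `μ` nonnegative, for the
  -- monotonicity in `sinh c.r`.
  set μ := max 0 (-Real.cos (α / 2)) with hμ
  have hμ1 : μ < 1 := by
    refine max_lt one_pos ?_
    have := Real.cos_lt_cos_of_nonneg_of_le_pi (by linarith) le_rfl
      (show α / 2 < Real.pi by linarith)
    rw [Real.cos_pi] at this
    linarith
  have hμ0 : 0 ≤ μ := le_max_left _ _
  -- The quotient distance is an infimum, so lifts are only available at distance below `s'` for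
  -- each `s' > s`. Letting `s' → s` gives `cosh (2 s) ≤ cosh² s + μ sinh² s`, which is false.
  have key : ∀ s', s < s' → Real.cosh (2 * s) ≤
      Real.cosh s * Real.cosh s' + μ * (Real.sinh s * Real.sinh s') := by
    intro s' hs'
    obtain ⟨z, hz, hlt⟩ := M.exists_lt b y s' (by rw [hby]; exact hs')
    set c := b.shift (-z) with hc
    have hcy : chd cutCos c y < Real.cosh s' := by
      rw [← cosh_adist hk, Real.cosh_lt_cosh, abs_of_nonneg (adist_nonneg hk _ _),
        abs_of_pos (hs0.trans hs'), ← adist_shift z, hc, shift_shift, add_neg_cancel, shift_zero]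
      exact hlt
    have hcy' : Real.cosh c.r * Real.cosh (c.ζ - y.ζ) < Real.cosh s' := by
      simpa [chd, hy] using hcy
    obtain ⟨m, hm, -⟩ := existsUnique_sub_zsmul_mem_Ico hα (0 - c.θ) (-(α / 2))
    have hw : (⟨0, m * α⟩ : ℂ) ∈ deckGroup α l τ := mem_deckGroup.2 ⟨0, m, by simp⟩
    have hle := M.dist_le a c _ hw
    rw [hc, ofCyl_shift b (neg_mem hz), hab, ← hc,
      ← abs_of_nonneg (adist_nonneg hk a _), ← abs_of_pos (show 0 < 2 * s by linarith),
      ← Real.cosh_le_cosh, cosh_adist hk] at hle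
    refine hle.trans ?_
    have hθ : |a.θ - (c.shift ⟨0, m * α⟩).θ| ≤ |α / 2| := by
      have e : a.θ - (c.shift ⟨0, m * α⟩).θ = 0 - c.θ - m • α := by
        simp only [shift, zsmul_eq_mul, ha]; ring
      rw [e, abs_of_pos (half_pos hα), abs_le]
      exact ⟨hm.1, by linarith [hm.2]⟩
    have hcut : -μ ≤ cutCos (a.θ - (c.shift ⟨0, m * α⟩).θ) := by
      have h1 := cutCos_anti hθ
      rw [cutCos_of_le (by rw [abs_of_pos (half_pos hα)]; linarith)] at h1
      have := le_max_right 0 (-Real.cos (α / 2))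
      linarith
    have hr : c.r ≤ s' := by
      have h1 := Real.one_le_cosh (c.ζ - y.ζ)
      have h2 : Real.cosh c.r < Real.cosh s' := by
        have := Real.cosh_pos c.r
        nlinarith
      rw [Real.cosh_lt_cosh, abs_of_nonneg c.r_nonneg, abs_of_pos (hs0.trans hs')] at h2
      exact h2.le
    have hsr : Real.sinh c.r ≤ Real.sinh s' := Real.sinh_le_sinh.2 hr
    have hss : 0 ≤ Real.sinh s := Real.sinh_nonneg_iff.2 hs0.le
    rw [chd]
    simp only [ha] at hcut ⊢
    simp only [shift, add_zero] at hcut ⊢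
    have e1 : Real.cosh (y.ζ - c.ζ) = Real.cosh (c.ζ - y.ζ) := by
      rw [← Real.cosh_neg, neg_sub]
    rw [e1]
    have h1 : Real.cosh s * (Real.cosh c.r * Real.cosh (c.ζ - y.ζ)) ≤
        Real.cosh s * Real.cosh s' := mul_le_mul_of_nonneg_left hcy'.le (Real.cosh_pos s).le
    have h2 := mul_nonneg (mul_nonneg hss c.sinh_r_nonneg) (neg_le_iff_add_nonneg.1 hcut)
    have h3 := mul_le_mul_of_nonneg_left hsr (mul_nonneg hμ0 hss)
    nlinarith
  have hlim : Filter.Tendsto (fun s' => Real.cosh s * Real.cosh s' +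
      μ * (Real.sinh s * Real.sinh s')) (nhdsWithin s (Set.Ioi s))
      (nhds (Real.cosh s * Real.cosh s + μ * (Real.sinh s * Real.sinh s))) :=
    (Continuous.tendsto (by fun_prop) s).mono_left nhdsWithin_le_nhds
  have := ge_of_tendsto hlim (by filter_upwards [self_mem_nhdsWithin] with s' hs' using key s' hs')
  rw [Real.cosh_two_mul] at this
  have hpos : 0 < Real.sinh s * Real.sinh s :=
    mul_pos (Real.sinh_pos_iff.2 hs0) (Real.sinh_pos_iff.2 hs0)
  nlinarith

theorem le_of_ballIsometric_of_singular {x : Cyl} {ρ : ℝ} (hα : 0 < α) (hα' : α < 2 * Real.pi)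
    (hball : BallIsometric (ofCyl α l τ x) ρ) : ρ ≤ x.r := by
  by_contra h
  have h1 := isQuotientModel_cutCos.comm (ofCyl α l τ x) (ofCyl α l τ ⟨0, x.ζ, x.θ, le_rfl⟩)
  have h2 := dist_ofCyl_le (α := α) (l := l) (τ := τ) x ⟨0, x.ζ, x.θ, le_rfl⟩
  rw [dist_eq_adist, adist_to_axis angleFun_cutCos, h1] at h2
  exact ball_disjoint_core hα hα' hball rfl (h2.trans_lt (not_le.1 h))

end ModelTorus

/-! ### Shortest displacements and the injectivity radius -/

namespace Cyl

theorem chd_shift_self {k : ℝ → ℝ} (hk : AngleFun k) (c : Cyl) (z : ℂ) :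
    chd k c (c.shift z) = Real.cosh c.r ^ 2 * Real.cosh z.re - Real.sinh c.r ^ 2 * k z.im := by
  simp only [chd, shift, sub_add_cancel_left, Real.cosh_neg, hk.even]
  ring

end Cyl

/-- The hyperbolic cosine of the distance by which a translation of length `n l` with angle cosine
`κ n` moves points at distance `r` from the axis. -/
noncomputable def disp (l : ℝ) (κ : ℕ → ℝ) (n : ℕ) (r : ℝ) : ℝ :=
  Real.cosh r ^ 2 * Real.cosh (n * l) - Real.sinh r ^ 2 * κ n

theorem cosh_le_disp {l : ℝ} {κ : ℕ → ℝ} (hκ : ∀ n, κ n ≤ 1) (n : ℕ) (r : ℝ) :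
    Real.cosh (n * l) ≤ disp l κ n r := by
  have h1 := Real.cosh_sq r
  have h2 := Real.one_le_cosh (n * l)
  rw [disp, h1]
  nlinarith [mul_nonneg (sq_nonneg (Real.sinh r)) (sub_nonneg.2 ((hκ n).trans h2))]

theorem finite_nat_mul_le {l : ℝ} (hl : 0 < l) (B : ℝ) : {n : ℕ | n * l ≤ B}.Finite := by
  refine (Set.finite_Iic ⌊B / l⌋₊).subset fun n hn => ?_
  exact Nat.le_floor ((le_div_iff₀ hl).2 hn)

theorem exists_min_disp {l : ℝ} (hl : 0 < l) {κ : ℕ → ℝ} (hκ : ∀ n, κ n ≤ 1) {I : Set ℕ}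
    (hI : I.Nonempty) (r : ℝ) : ∃ n ∈ I, ∀ m ∈ I, disp l κ n r ≤ disp l κ m r := by
  obtain ⟨n₁, hn₁⟩ := hI
  have hfin : {m | m ∈ I ∧ disp l κ m r ≤ disp l κ n₁ r}.Finite := by
    refine (finite_nat_mul_le hl (Real.arcosh (disp l κ n₁ r))).subset fun m hm => ?_
    have h1 := (cosh_le_disp hκ m r).trans hm.2
    have h2 := Real.one_le_cosh (m * l)
    show m * l ≤ _
    rw [← Real.arcosh_cosh (show 0 ≤ m * l by positivity),
      Real.arcosh_le_arcosh (Real.cosh_pos _) (by linarith)]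
    exact h1
  obtain ⟨n, hn, hmin⟩ := Set.exists_min_image _ (fun m => disp l κ m r) hfin ⟨n₁, hn₁, le_rfl⟩
  refine ⟨n, hn.1, fun m hm => ?_⟩
  by_cases h : disp l κ m r ≤ disp l κ n₁ r
  · exact hmin m ⟨hm, h⟩
  · exact hn.2.trans (not_le.1 h).le

namespace ModelTorus

open Cyl

/-- The functions `disp l κ n`, `n ∈ I`, list the displacements of the shortest elements of `S`. -/
structure HasDisplacements (l : ℝ) (k : ℝ → ℝ) (S : AddSubgroup ℂ) (I : Set ℕ) (κ : ℕ → ℝ) :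
    Prop where
  angle : AngleFun k
  nonempty : I.Nonempty
  le_one : ∀ n, κ n ≤ 1
  exists_mem : ∀ n ∈ I, ∃ z ∈ S, z ≠ 0 ∧ ∀ c : Cyl, chd k c (c.shift z) = disp l κ n c.r
  exists_le : ∀ z ∈ S, z ≠ 0 → ∃ n ∈ I, ∀ c : Cyl, disp l κ n c.r ≤ chd k c (c.shift z)

theorem HasDisplacements.exists_min {l : ℝ} {k : ℝ → ℝ} {S : AddSubgroup ℂ} {I : Set ℕ}
    {κ : ℕ → ℝ} (H : HasDisplacements l k S I κ) (hl : 0 < l) (c : Cyl) :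
    ∃ z₀ ∈ S, z₀ ≠ 0 ∧ (∀ z ∈ S, z ≠ 0 → adist k c (c.shift z₀) ≤ adist k c (c.shift z)) ∧
      ∀ ε, 0 ≤ ε → (adist k c (c.shift z₀) ≤ ε ↔ ∃ n ∈ I, disp l κ n c.r ≤ Real.cosh ε) := by
  obtain ⟨n, hn, hmin⟩ := exists_min_disp hl H.le_one H.nonempty c.r
  obtain ⟨z₀, hz₀, hne, he⟩ := H.exists_mem n hn
  refine ⟨z₀, hz₀, hne, fun z hz hz' => ?_, fun ε hε => ?_⟩
  · obtain ⟨m, hm, hle⟩ := H.exists_le z hz hz'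
    rw [adist_le_iff H.angle (adist_nonneg H.angle _ _), cosh_adist H.angle, he]
    exact (hmin m hm).trans (hle c)
  · rw [adist_le_iff H.angle hε, he]
    exact ⟨fun h => ⟨n, hn, h⟩, fun ⟨m, hm, h⟩ => (hmin m hm).trans h⟩

variable {l τ : ℝ}

theorem zsmul_mk (n : ℤ) (l τ : ℝ) : n • (⟨l, τ⟩ : ℂ) = ⟨n * l, n * τ⟩ := by
  apply Complex.ext <;> simp

theorem hasDisplacements_cos (hl : 0 < l) : HasDisplacements l Real.cos
    (AddSubgroup.zmultiples ⟨l, τ⟩) {n | 1 ≤ n} (fun n => Real.cos (n * τ)) where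
  angle := angleFun_cos
  nonempty := ⟨1, le_refl (1 : ℕ)⟩
  le_one n := Real.cos_le_one _
  exists_mem n hn := by
    have hn : 1 ≤ n := hn
    refine ⟨(n : ℤ) • ⟨l, τ⟩, zsmul_mem (AddSubgroup.mem_zmultiples _) _, fun h => ?_, fun c => ?_⟩
    · rw [zsmul_mk] at h
      have h1 : ((n : ℤ) : ℝ) * l = 0 := congrArg Complex.re h
      have h2 : (0 : ℝ) < ((n : ℤ) : ℝ) := by exact_mod_cast hn
      exact (mul_pos h2 hl).ne' h1
    · rw [chd_shift_self angleFun_cos, disp, zsmul_mk, Int.cast_natCast]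
  exists_le z hz hne := by
    obtain ⟨n, rfl⟩ := AddSubgroup.mem_zmultiples_iff.1 hz
    refine ⟨n.natAbs, ?_, fun c => le_of_eq ?_⟩
    · have : n ≠ 0 := fun h => hne (by rw [h, zero_smul])
      exact Int.natAbs_pos.2 this
    · rw [chd_shift_self angleFun_cos, disp, zsmul_mk]
      simp only
      rcases Int.natAbs_eq n with h | h
      · rw [← Int.cast_natCast, ← h]
      · have : (n.natAbs : ℝ) = -n := by
          rw [← Int.cast_natCast, show ((n.natAbs : ℤ)) = -n by omega, Int.cast_neg]
        rw [this, neg_mul, neg_mul, Real.cosh_neg, Real.cos_neg]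

theorem abs_angleMod_le {α : ℝ} (hα : 0 < α) (a : ℝ) : |angleMod a α hα| ≤ α / 2 := by
  have h1 := left_le_toIcoMod hα (-(α / 2)) a
  have h2 := toIcoMod_lt_right hα (-(α / 2)) a
  rw [angleMod, abs_le]
  constructor <;> linarith

theorem exists_angleMod_eq {α : ℝ} (hα : 0 < α) (a : ℝ) : ∃ m : ℤ, angleMod a α hα = a + m * α :=
  ⟨-toIcoDiv hα (-(α / 2)) a, by
    rw [angleMod, toIcoMod, zsmul_eq_mul, Int.cast_neg]; ring⟩

theorem abs_angleMod_le_abs {α : ℝ} (hα : 0 < α) (a : ℝ) (m : ℤ) :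
    |angleMod a α hα| ≤ |a + m * α| := by
  obtain ⟨m', hm'⟩ := exists_angleMod_eq hα a
  have h1 := abs_angleMod_le hα a
  rcases eq_or_ne m m' with rfl | hne
  · rw [hm']
  · have h2 : (1 : ℝ) ≤ |((m - m' : ℤ) : ℝ)| := by
      rw [← Int.cast_abs]
      exact_mod_cast Int.one_le_abs (sub_ne_zero.2 hne)
    have h3 : a + m * α = angleMod a α hα + ((m - m' : ℤ) : ℝ) * α := by
      rw [hm']; push_cast; ring
    have h4 : α ≤ |((m - m' : ℤ) : ℝ) * α| := by
      rw [abs_mul, abs_of_pos hα]; nlinarith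
    have h5 := abs_sub_abs_le_abs_sub (((m - m' : ℤ) : ℝ) * α) (-angleMod a α hα)
    rw [abs_neg, sub_neg_eq_add, add_comm (((m - m' : ℤ) : ℝ) * α), ← h3] at h5
    linarith

/-- The cosine of the angle of the shortest elements that translate by `n l`. -/
noncomputable def coneCos (α τ : ℝ) (hα : 0 < α) (n : ℕ) : ℝ :=
  if n = 0 then cutCos α else cutCos (angleMod (n * τ) α hα)

/-- Since `cutCos` decreases in the absolute angle, the shortest element translating by `n l` has
its angle reduced to the representative nearest zero. Index `0` is special: that representative
would be the identity, so the rotation by `α` replaces it. -/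
theorem hasDisplacements_cutCos {α : ℝ} (hα : 0 < α) (hl : 0 < l) :
    HasDisplacements l cutCos (deckGroup α l τ) Set.univ (coneCos α τ hα) where
  angle := angleFun_cutCos
  nonempty := Set.univ_nonempty
  le_one n := by
    unfold coneCos
    split_ifs <;> exact angleFun_cutCos.le_one _
  exists_mem n _ := by
    rcases eq_or_ne n 0 with rfl | hn
    · refine ⟨⟨0, α⟩, mem_deckGroup.2 ⟨0, 1, by simp⟩, fun h => ?_, fun c => ?_⟩
      · exact hα.ne' (congrArg Complex.im h)
      · rw [chd_shift_self angleFun_cutCos, disp, coneCos]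
        simp
    · obtain ⟨m, hm⟩ := exists_angleMod_eq hα (n * τ)
      refine ⟨⟨n * l, angleMod (n * τ) α hα⟩, mem_deckGroup.2 ⟨n, m, by rw [hm]; simp⟩,
        fun h => ?_, fun c => ?_⟩
      · have h1 : (n : ℝ) * l = 0 := congrArg Complex.re h
        exact (mul_ne_zero (Nat.cast_ne_zero.2 hn) hl.ne') h1
      · rw [chd_shift_self angleFun_cutCos, disp, coneCos, if_neg hn]
  exists_le z hz hne := by
    obtain ⟨n, m, rfl⟩ := mem_deckGroup.1 hz
    refine ⟨n.natAbs, trivial, fun c => ?_⟩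
    rw [chd_shift_self angleFun_cutCos, disp]
    have hre : Real.cosh (n.natAbs * l) = Real.cosh (n * l) := by
      rw [← Real.cosh_abs (n * l), abs_mul, abs_of_pos hl, Nat.cast_natAbs, Int.cast_abs]
    rw [hre]
    refine sub_le_sub_left (mul_le_mul_of_nonneg_left ?_ (sq_nonneg _)) _
    simp only
    rcases eq_or_ne n 0 with rfl | hn
    · have hm : m ≠ 0 := fun h => hne (by rw [h]; apply Complex.ext <;> simp)
      rw [coneCos, Int.natAbs_zero, if_pos rfl]
      refine cutCos_anti ?_
      have h2 : (1 : ℝ) ≤ |(m : ℝ)| := by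
        rw [← Int.cast_abs]
        exact_mod_cast Int.one_le_abs hm
      rw [Int.cast_zero, zero_mul, zero_add, abs_mul]
      nlinarith [abs_pos.2 hα.ne']
    · rw [coneCos, if_neg (Int.natAbs_ne_zero.2 hn)]
      rcases Int.natAbs_eq n with h | h
      · have e : (n : ℝ) = n.natAbs := by rw [← Int.cast_natCast, ← h]
        rw [e]
        exact cutCos_anti (abs_angleMod_le_abs hα _ m)
      · have e : (n : ℝ) = -n.natAbs := by
          rw [← Int.cast_natCast, ← Int.cast_neg, ← h]
        rw [← cutCos_neg (n * τ + m * α), e,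
          show -(-(n.natAbs : ℝ) * τ + m * α) = n.natAbs * τ + (-m : ℤ) * α by push_cast; ring]
        exact cutCos_anti (abs_angleMod_le_abs hα _ (-m))

variable {α : ℝ}

theorem injrad_eq_of_isGreatest {x : ModelTorus α l τ} {R : ℝ}
    (hx : α = 2 * Real.pi ∨ x ∉ core α l τ) (h : BallIsometric x R) (hR : 0 ≤ R)
    (hle : ∀ ρ, BallIsometric x ρ → ρ ≤ R) : injrad x = R := by
  rw [injrad, if_neg (by tauto)]
  exact IsGreatest.csSup_eq ⟨⟨hR, h⟩, fun ρ hρ => hle ρ hρ.2⟩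

theorem HasDisplacements.exists_pos_le {k : ℝ → ℝ} {S : AddSubgroup ℂ} {I : Set ℕ}
    {κ : ℕ → ℝ} (H : HasDisplacements l k S I κ) (hl : 0 < l) (c : Cyl)
    (hpos : ∀ z ∈ S, z ≠ 0 → 1 < chd k c (c.shift z)) :
    ∃ η > 0, ∀ z ∈ S, z ≠ 0 → η ≤ adist k c (c.shift z) := by
  obtain ⟨z₀, hz₀, hne, hmin, -⟩ := H.exists_min hl c
  exact ⟨_, Real.arcosh_pos (hpos z₀ hz₀ hne), hmin⟩

theorem one_lt_chd_cos (hl : 0 < l) (c : Cyl) {z : ℂ}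
    (hz : z ∈ AddSubgroup.zmultiples (⟨l, τ⟩ : ℂ)) (hne : z ≠ 0) :
    1 < chd Real.cos c (c.shift z) := by
  obtain ⟨n, hn, h⟩ := (hasDisplacements_cos (τ := τ) hl).exists_le z hz hne
  have hn : 1 ≤ n := hn
  refine lt_of_lt_of_le ?_ ((cosh_le_disp (fun n => Real.cos_le_one _) n c.r).trans (h c))
  rw [Real.one_lt_cosh]
  have : (0 : ℝ) < n := by exact_mod_cast hn
  positivity

theorem one_lt_chd_cutCos (c : Cyl) (hc : 0 < c.r) {z : ℂ} (hne : z ≠ 0) :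
    1 < chd cutCos c (c.shift z) := by
  rw [chd_shift_self angleFun_cutCos]
  have h1 := Real.cosh_sq c.r
  have h2 := Real.one_le_cosh z.re
  have h3 : 0 < Real.sinh c.r ^ 2 := pow_pos (Real.sinh_pos_iff.2 hc) 2
  rcases eq_or_ne z.im 0 with h | h
  · have h4 : 1 < Real.cosh z.re :=
      Real.one_lt_cosh.2 fun h' => hne (Complex.ext h' h)
    have h5 := angleFun_cutCos.le_one z.im
    rw [h1]
    nlinarith [mul_nonneg h3.le (sub_nonneg.2 h5)]
  · have h5 := cutCos_lt_one h
    rw [h1]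
    nlinarith [mul_pos h3 (sub_pos.2 h5), mul_nonneg h3.le (sub_nonneg.2 h2)]

/-- The chart of `ℍ³` centred at `c` serves for the embedded ball, and the segment from `c` to its
shortest translate closes up to the obstructing loop. -/
theorem injrad_nonsingular (hl : 0 < l) (c : Cyl) {z₀ : ℂ}
    (hz₀ : z₀ ∈ AddSubgroup.zmultiples (⟨l, τ⟩ : ℂ)) (hne : z₀ ≠ 0)
    (hmin : ∀ z ∈ AddSubgroup.zmultiples (⟨l, τ⟩ : ℂ), z ≠ 0 →
      adist Real.cos c (c.shift z₀) ≤ adist Real.cos c (c.shift z)) :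
    injrad (ofCyl (2 * Real.pi) l τ c) = adist Real.cos c (c.shift z₀) / 2 := by
  have M := isQuotientModel_cos (l := l) (τ := τ)
  have hL : 0 < adist Real.cos c (c.shift z₀) := Real.arcosh_pos (one_lt_chd_cos hl c hz₀ hne)
  have h2 : 2 * (adist Real.cos c (c.shift z₀) / 2) = adist Real.cos c (c.shift z₀) := by ring
  have hmin' : ∀ z ∈ AddSubgroup.zmultiples (⟨l, τ⟩ : ℂ), z ≠ 0 →
      2 * (adist Real.cos c (c.shift z₀) / 2) ≤ adist Real.cos c (c.shift z) := by rwa [h2]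
  refine injrad_eq_of_isGreatest (Or.inl rfl) ?_ (by positivity) fun ρ hρ => ?_
  · obtain ⟨Ψ, h1, hb, -, h4⟩ := HypThree.exists_chart c
    refine M.ballIsometric hmin' hb (fun a _ b _ => h1 a b) fun d hd => ?_
    obtain ⟨p, hp⟩ := h4 d
    refine ⟨p, ?_, hp⟩
    show dist p HypThree.base < _
    rwa [← h1, adist_cos_congr hp, adist_comm angleFun_cos, adist_cos_congr hb,
      adist_comm angleFun_cos]
  · obtain ⟨γ, hγ⟩ := exists_segment_cos c (c.shift z₀) hL
    obtain ⟨η, hη, hm⟩ := (hasDisplacements_cos (τ := τ) hl).exists_pos_le hl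
      (γ (adist Real.cos c (c.shift z₀) / 2)) fun z hz hz' => one_lt_chd_cos hl _ hz hz'
    exact M.le_of_ballIsometric (half_pos hL) hz₀ hmin' (by rwa [h2]) hη hm hρ

theorem abs_lt_pi_div_two_of_cutCos_pos {θ : ℝ} (h : 0 < cutCos θ) : |θ| < Real.pi / 2 := by
  by_contra h'
  have hpi := Real.pi_pos
  have h0 : |Real.pi / 2| = Real.pi / 2 := abs_of_pos (by positivity)
  have h1 := cutCos_anti (θ := Real.pi / 2) (φ := θ) (by rw [h0]; exact not_lt.1 h')
  rw [cutCos_of_le (θ := Real.pi / 2) (by rw [h0]; linarith), Real.cos_pi_div_two] at h1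
  linarith

/-- At an obtuse angle, the law of cosines puts `p` at least as far from `q` as the axis is. -/
theorem angle_pos_of_chd_lt {k : ℝ → ℝ} {p q : Cyl} (h : chd k p q < Real.cosh q.r) :
    0 < k (p.θ - q.θ) := by
  by_contra h'
  have h1 := mul_nonneg (mul_nonneg p.sinh_r_nonneg q.sinh_r_nonneg) (neg_nonneg.2 (not_lt.1 h'))
  have h2 := one_le_mul_of_one_le_of_one_le (Real.one_le_cosh p.r) (Real.one_le_cosh (p.ζ - q.ζ))
  have h3 := Real.cosh_pos q.r
  rw [chd] at h
  nlinarith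

theorem two_mul_r_le_adist (c : Cyl) {z : ℂ} (h : Real.pi ≤ |z.im|) :
    2 * c.r ≤ adist cutCos c (c.shift z) := by
  have h1 : Real.cosh (2 * c.r) ≤ chd cutCos c (c.shift z) := by
    rw [chd_shift_self angleFun_cutCos, cutCos_of_ge h, Real.cosh_two_mul]
    nlinarith [Real.one_le_cosh z.re, sq_nonneg (Real.cosh c.r)]
  rwa [← cosh_adist angleFun_cutCos, Real.cosh_le_cosh, abs_of_nonneg (by linarith [c.r_nonneg]),
    abs_of_nonneg (adist_nonneg angleFun_cutCos _ _)] at h1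

theorem adist_le_two_mul_r (c : Cyl) (t : ℝ) : adist cutCos c (c.shift ⟨0, t⟩) ≤ 2 * c.r := by
  have hk := angleFun_cutCos
  rw [adist_le_iff hk (by linarith [c.r_nonneg]), chd_shift_self hk, Real.cosh_two_mul,
    Real.cosh_zero]
  nlinarith [hk.neg_one_le t, sq_nonneg (Real.sinh c.r)]

/-- The rotation by `α` displaces `c` by at most `2 * c.r`, so `R ≤ c.r`. The ball about `c` then
stays within angle `π / 2` of `c`, where `cutCos` agrees with `cos` and the hyperbolic chart is
isometric. -/
theorem injrad_singular (hα : 0 < α) (hα' : α < 2 * Real.pi) (hl : 0 < l) (c : Cyl) (hc : 0 < c.r)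
    {z₀ : ℂ} (hz₀ : z₀ ∈ deckGroup α l τ) (hne : z₀ ≠ 0)
    (hmin : ∀ z ∈ deckGroup α l τ, z ≠ 0 →
      adist cutCos c (c.shift z₀) ≤ adist cutCos c (c.shift z)) :
    injrad (ofCyl α l τ c) = adist cutCos c (c.shift z₀) / 2 := by
  have M := isQuotientModel_cutCos (α := α) (l := l) (τ := τ)
  have hk := angleFun_cutCos
  have hL : 0 < adist cutCos c (c.shift z₀) := Real.arcosh_pos (one_lt_chd_cutCos c hc hne)
  set R := adist cutCos c (c.shift z₀) / 2 with hR
  have h2 : 2 * R = adist cutCos c (c.shift z₀) := by rw [hR]; ring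
  have hmin' : ∀ z ∈ deckGroup α l τ, z ≠ 0 → 2 * R ≤ adist cutCos c (c.shift z) := by rwa [h2]
  have hRc : R ≤ c.r := by
    have h1 := hmin' ⟨0, α⟩ (mem_deckGroup.2 ⟨0, 1, by simp⟩)
      fun h => hα.ne' (congrArg Complex.im h)
    have := adist_le_two_mul_r c α
    linarith
  refine injrad_eq_of_isGreatest (Or.inr fun h => hc.ne' (ofCyl_mem_core.1 h)) ?_ (by positivity)
    fun ρ hρ => ?_
  · obtain ⟨Ψ, h1, hb, hθ, h4⟩ := HypThree.exists_chart c
    have hang : ∀ {k : ℝ → ℝ} (_ : AngleFun k) {q : Cyl}, adist k q c < R →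
        0 < k (q.θ - c.θ) := by
      intro k hk q hq
      refine angle_pos_of_chd_lt ?_
      rw [← cosh_adist hk, Real.cosh_lt_cosh, abs_of_nonneg (adist_nonneg hk _ _), abs_of_pos hc]
      exact hq.trans_le hRc
    have hsmall : ∀ a ∈ HypThree.baseBall R, |(Ψ a).θ - c.θ| < Real.pi / 2 := by
      intro a ha
      refine abs_lt_pi_div_two_of_cutCos_pos ?_
      rw [cutCos_of_le (hθ a)]
      refine hang angleFun_cos ?_
      rw [adist_comm angleFun_cos, ← adist_cos_congr hb, h1, dist_comm]
      exact ha
    have conv : ∀ {p q : Cyl}, |p.θ - c.θ| < Real.pi / 2 → |q.θ - c.θ| < Real.pi / 2 →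
        adist cutCos p q = adist Real.cos p q := by
      intro p q hp hq
      rw [adist, adist, chd_eq_of_angle (cutCos_of_le _)]
      rw [abs_lt] at hp hq
      rw [abs_le]
      constructor <;> linarith
    have hc0 : |c.θ - c.θ| < Real.pi / 2 := by
      rw [sub_self, abs_zero]; exact Real.pi_div_two_pos
    refine M.ballIsometric (Ψ := Ψ) hmin' ?_ (fun a ha b hb => ?_) fun d hd => ?_
    · rw [adist, chd_eq_of_angle (cutCos_of_le (hθ _)), ← adist, hb]
    · rw [conv (hsmall a ha) (hsmall b hb), h1]
    · have hd' := abs_lt_pi_div_two_of_cutCos_pos (hang hk hd)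
      obtain ⟨p, hp⟩ := h4 d
      have hpm : p ∈ HypThree.baseBall R := by
        show dist p HypThree.base < R
        rwa [← h1, adist_cos_congr hp, adist_comm angleFun_cos, adist_cos_congr hb,
          adist_comm angleFun_cos, ← conv hd' hc0]
      exact ⟨p, hpm, by rw [conv (hsmall p hpm) hd', hp]⟩
  -- Below angle `π` the loop avoids the axis and the general obstruction applies. Otherwise `c.r ≤
  -- R`, and a hyperbolic ball cannot reach beyond the core.
  · rcases lt_or_ge |z₀.im| Real.pi with him | him
    · obtain ⟨γ, hγ, hγr⟩ := exists_segment_cutCos c (c.shift z₀) hL hc hc (by simpa [shift] using him)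
      have hmem : R ∈ Set.Icc 0 (adist cutCos c (c.shift z₀)) := ⟨by positivity, by linarith⟩
      obtain ⟨η, hη, hm⟩ := (hasDisplacements_cutCos (τ := τ) hα hl).exists_pos_le hl (γ R)
        fun z _ hz' => one_lt_chd_cutCos _ (hγr R hmem) hz'
      exact M.le_of_ballIsometric (half_pos hL) hz₀ hmin' (by rwa [h2]) hη hm hρ
    · have h3 := two_mul_r_le_adist c him
      have h4 := le_of_ballIsometric_of_singular hα hα' hρ
      linarith

end ModelTorus

/-! ### Translation radii -/

open Cyl in
theorem dist_pt_vadd (l t r ζ θ : ℝ) (hr : 0 ≤ r) :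
    dist (HHat.pt r ζ θ hr) ((⟨l, t⟩ : ℂ) +ᵥ HHat.pt r ζ θ hr) =
      adist cutCos ⟨r, ζ, θ, hr⟩ (shift ⟨l, t⟩ ⟨r, ζ, θ, hr⟩) := by
  rw [HHat.vadd_pt, HHat.pt, HHat.pt, SeparationQuotient.dist_mk, dist_eq_adist, shift]

/-- This form shows the displacement as affine in `cosh² r` with slope `C - k`, so it can be
compared and solved for `r`. -/
theorem cosh_sq_mul_sub {r C k : ℝ} : Real.cosh r ^ 2 * C - Real.sinh r ^ 2 * k =
    Real.cosh r ^ 2 * (C - k) + k := by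
  rw [Real.cosh_sq]; ring

theorem trad_of_lt {l t ε : ℝ} (h : ε < l) : trad l t ε = ⊥ := if_pos h

theorem one_le_trad_ratio {l ε k : ℝ} (hl : 0 ≤ l) (hε : l ≤ ε) (h : k < Real.cosh l) :
    1 ≤ (Real.cosh ε - k) / (Real.cosh l - k) := by
  rw [one_le_div (sub_pos.2 h)]
  have : Real.cosh l ≤ Real.cosh ε := by
    rwa [Real.cosh_le_cosh, abs_of_nonneg hl, abs_of_nonneg (hl.trans hε)]
  linarith

theorem trad_of_le {l t ε : ℝ} (hl : 0 ≤ l) (hε : l ≤ ε) (h : cutCos t < Real.cosh l) :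
    trad l t ε = (Real.arcosh √((Real.cosh ε - cutCos t) / (Real.cosh l - cutCos t)) : ℝ) := by
  set q := (Real.cosh ε - cutCos t) / (Real.cosh l - cutCos t) with hq
  have hq1 : 1 ≤ q := one_le_trad_ratio hl hε h
  have hs : 1 ≤ √q := Real.one_le_sqrt.2 hq1
  have hpos := sub_pos.2 h
  have key : ∀ (r : ℝ) (hr : 0 ≤ r), (∀ ζ θ : ℝ, dist (HHat.pt r ζ θ hr)
      ((⟨l, t⟩ : ℂ) +ᵥ HHat.pt r ζ θ hr) = ε) ↔ r = Real.arcosh √q := by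
    intro r hr
    have e : ∀ ζ θ : ℝ, (dist (HHat.pt r ζ θ hr) ((⟨l, t⟩ : ℂ) +ᵥ HHat.pt r ζ θ hr) = ε ↔
        r = Real.arcosh √q) := by
      intro ζ θ
      rw [dist_pt_vadd, Cyl.adist_eq_iff angleFun_cutCos (hl.trans hε),
        Cyl.chd_shift_self angleFun_cutCos]
      simp only
      rw [cosh_sq_mul_sub, ← eq_sub_iff_add_eq, ← eq_div_iff hpos.ne', ← hq,
        ← Real.cosh_injOn.eq_iff hr (Real.arcosh_nonneg hs), Real.cosh_arcosh hs, eq_comm (b := √q),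
        Real.sqrt_eq_iff_eq_sq (by linarith) (Real.cosh_pos r).le, eq_comm]
    exact ⟨fun h => (e 0 0).1 (h 0 0), fun h ζ θ => (e ζ θ).2 h⟩
  rw [trad, if_neg (not_lt.2 hε)]
  have : {x : EReal | ∃ (r : ℝ) (hr : 0 ≤ r), x = (r : EReal) ∧ ∀ ζ θ : ℝ,
      dist (HHat.pt r ζ θ hr) ((⟨l, t⟩ : ℂ) +ᵥ HHat.pt r ζ θ hr) = ε} =
      {((Real.arcosh √q : ℝ) : EReal)} := by
    ext x
    simp only [Set.mem_ofPred_eq, Set.mem_singleton_iff]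
    constructor
    · rintro ⟨r, hr, rfl, h⟩
      rw [(key r hr).1 h]
    · rintro rfl
      exact ⟨_, Real.arcosh_nonneg hs, rfl, (key _ _).2 rfl⟩
  rw [this, sSup_singleton]

theorem trad_ne_top {l t ε : ℝ} (hl : 0 ≤ l) (h : cutCos t < Real.cosh l) : trad l t ε ≠ ⊤ := by
  rcases lt_or_ge ε l with h' | h'
  · rw [trad_of_lt h']; exact bot_ne_top
  · rw [trad_of_le hl h' h]; exact EReal.coe_ne_top _

/-- The displacement increases with `r`, so it is at most `ε` exactly up to the radius where it
equals `ε`. If `ε < l` both sides fail, since every point moves by at least `l`. -/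
theorem le_trad_iff {l t ε r : ℝ} (hl : 0 ≤ l) (hε : 0 ≤ ε) (h : cutCos t < Real.cosh l)
    (hr : 0 ≤ r) : (r : EReal) ≤ trad l t ε ↔
      Real.cosh r ^ 2 * Real.cosh l - Real.sinh r ^ 2 * cutCos t ≤ Real.cosh ε := by
  rcases lt_or_ge ε l with h' | h'
  · rw [trad_of_lt h']
    have h1 : Real.cosh ε < Real.cosh l := by
      rwa [Real.cosh_lt_cosh, abs_of_nonneg hε, abs_of_nonneg hl]
    have h2 := Real.one_le_cosh r
    refine iff_of_false (fun h => EReal.coe_ne_bot r (le_bot_iff.1 h)) (not_le.2 ?_)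
    rw [cosh_sq_mul_sub]
    nlinarith [mul_nonneg (by nlinarith : 0 ≤ Real.cosh r ^ 2 - 1) (sub_pos.2 h).le]
  · have hs := one_le_trad_ratio hl h' h
    rw [trad_of_le hl h' h, EReal.coe_le_coe_iff, ← abs_of_nonneg hr,
      ← abs_of_nonneg (Real.arcosh_nonneg (Real.one_le_sqrt.2 hs)), ← Real.cosh_le_cosh,
      Real.cosh_arcosh (Real.one_le_sqrt.2 hs), abs_of_nonneg hr,
      Real.le_sqrt' (Real.cosh_pos r), le_div_iff₀ (sub_pos.2 h), cosh_sq_mul_sub,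
      le_sub_iff_add_le]

theorem arccoshBot_eq_trad {l t ε k : ℝ} (hl : 0 ≤ l) (hε : 0 ≤ ε) (hk : cutCos t = k)
    (h : k < Real.cosh l) :
    arccoshBot √((Real.cosh ε - k) / (Real.cosh l - k)) = trad l t ε := by
  rcases lt_or_ge ε l with h' | h'
  · have h1 : Real.cosh ε < Real.cosh l := by
      rwa [Real.cosh_lt_cosh, abs_of_nonneg hε, abs_of_nonneg hl]
    rw [trad_of_lt h', arccoshBot, if_pos]
    rw [Real.sqrt_lt' one_pos, one_pow, div_lt_one (sub_pos.2 h)]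
    linarith
  · rw [trad_of_le hl h' (hk ▸ h), arccoshBot, hk,
      if_neg (not_lt.2 (Real.one_le_sqrt.2 (one_le_trad_ratio hl h' h)))]

theorem exists_isGreatest_of_finite {T : ℕ → EReal} (h : {n | T n ≠ ⊥}.Finite) {I : Set ℕ}
    (hI : I.Nonempty) : ∃ M, IsGreatest {x | ∃ n ∈ I, x = T n} M := by
  obtain ⟨n₀, hn₀⟩ := hI
  have hfin : {x | ∃ n ∈ I, x = T n}.Finite := by
    refine ((h.image T).insert ⊥).subset ?_
    rintro _ ⟨n, -, rfl⟩
    by_cases hn : T n = ⊥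
    · exact Or.inl hn
    · exact Or.inr ⟨n, hn, rfl⟩
  obtain ⟨M, hM, hmax⟩ := Set.exists_max_image _ id hfin ⟨_, n₀, hn₀, rfl⟩
  exact ⟨M, hM, fun x hx => hmax x hx⟩

theorem finite_trad_ne_bot {l : ℝ} (hl : 0 < l) (t : ℕ → ℝ) (ε : ℝ) :
    {n : ℕ | trad (n * l) (t n) ε ≠ ⊥}.Finite := by
  refine (finite_nat_mul_le hl ε).subset fun n hn => ?_
  by_contra h
  exact hn (trad_of_lt (not_le.1 h))

/-! ### The thin part as a tube, and its boundary -/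

namespace ModelTorus

open Cyl

variable {α l τ : ℝ}

theorem continuous_coreDist : Continuous (coreDist : ModelTorus α l τ → ℝ) := by
  -- One quotient topology for the orbit space and one for the identification of points at distance
  -- zero.
  refine continuous_coinduced_dom.2 ?_
  refine continuous_coinduced_dom.2 ?_
  have : Continuous fun c : Cyl => c.r := by
    refine (LipschitzWith.of_dist_le_mul (K := 1) fun p q => ?_).continuous
    rw [NNReal.coe_one, one_mul, Real.dist_eq, dist_eq_adist]
    exact abs_sub_r_le_adist angleFun_cutCos p q
  exact this.congr fun c => (coreDist_ofCyl c).symm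

theorem continuous_ofCyl : Continuous (ofCyl α l τ) :=
  continuous_quot_mk.comp SeparationQuotient.continuous_mk

/-- Any point at radius `r`, even on the core, can be pushed outward by an arbitrarily small amount,
so it is not interior. -/
theorem frontier_coreDist_le (r : ℝ) :
    frontier {x : ModelTorus α l τ | coreDist x ≤ r} = equidistant α l τ r := by
  rw [(isClosed_le continuous_coreDist continuous_const).frontier_eq]
  ext x
  constructor
  · rintro ⟨h1, h2⟩
    refine le_antisymm h1 (not_lt.1 fun h => h2 ?_)
    exact interior_maximal (fun y (hy : coreDist y < r) => hy.le)
      (isOpen_lt continuous_coreDist continuous_const) h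
  · intro (h : coreDist x = r)
    refine ⟨h.le, fun hint => ?_⟩
    obtain ⟨c, rfl⟩ := exists_ofCyl x
    rw [coreDist_ofCyl] at h
    have hopen := isOpen_interior.preimage (continuous_ofCyl (α := α) (l := l) (τ := τ))
      (t := interior {x : ModelTorus α l τ | coreDist x ≤ r})
    obtain ⟨e, he, hball⟩ := Metric.isOpen_iff.1 hopen c hint
    set c' : Cyl := ⟨c.r + e / 2, c.ζ, c.θ, by linarith [c.r_nonneg]⟩ with hc'
    have hd : dist c' c < e := by
      have : adist cutCos c' c = e / 2 := by
        rw [adist_eq_iff angleFun_cutCos (by positivity), chd]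
        simp only [hc', sub_self, Real.cosh_zero, angleFun_cutCos.zero, mul_one]
        rw [← Real.cosh_sub, add_sub_cancel_left]
      rw [dist_eq_adist, this]
      linarith
    have h1 := interior_subset (hball hd)
    have h2 : coreDist (ofCyl α l τ c') ≤ r := h1
    rw [coreDist_ofCyl, hc'] at h2
    simp only at h2
    linarith

/-- Uniqueness holds because every equidistant set of nonnegative radius is nonempty and determines
its radius. -/
theorem isTubeRadius_iff {ε R : ℝ} (hR : 0 ≤ R)
    (h : thin α l τ ε = {x | coreDist x ≤ R}) (r' : ℝ) : IsTubeRadius α l τ ε r' ↔ r' = R := by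
  rw [IsTubeRadius, h, frontier_coreDist_le]
  constructor
  · rintro ⟨-, h⟩
    have hmem : ofCyl α l τ ⟨R, 0, 0, hR⟩ ∈ equidistant α l τ R := coreDist_ofCyl _
    rw [h] at hmem
    exact hmem.symm.trans (coreDist_ofCyl _)
  · rintro rfl
    exact ⟨hR, rfl⟩

theorem injrad_nonneg (x : ModelTorus α l τ) : 0 ≤ injrad x := by
  rw [injrad]
  split_ifs
  · exact le_rfl
  · exact Real.sSup_nonneg fun ρ hρ => hρ.1

theorem eps_nonneg {ε : ℝ} (h : (thin α l τ ε).Nonempty) : 0 ≤ ε := by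
  obtain ⟨x, hx⟩ := h
  have h1 : injrad x ≤ ε / 2 := hx
  linarith [injrad_nonneg x]

theorem mem_thin_nonsingular (hl : 0 < l) {ε : ℝ} (hε : 0 ≤ ε) (c : Cyl) :
    ofCyl (2 * Real.pi) l τ c ∈ thin (2 * Real.pi) l τ ε ↔
      ∃ n ∈ {n : ℕ | 1 ≤ n}, disp l (fun n => Real.cos (n * τ)) n c.r ≤ Real.cosh ε := by
  obtain ⟨z₀, hz₀, hne, hmin, hiff⟩ := (hasDisplacements_cos (τ := τ) hl).exists_min hl c
  rw [← hiff ε hε, thin, Set.mem_ofPred_eq, injrad_nonsingular hl c hz₀ hne hmin,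
    div_le_div_iff_of_pos_right two_pos]

theorem mem_thin_singular (hα : 0 < α) (hα' : α < 2 * Real.pi) (hl : 0 < l) {ε : ℝ} (hε : 0 ≤ ε)
    (c : Cyl) : ofCyl α l τ c ∈ thin α l τ ε ↔
      ∃ n ∈ Set.univ, disp l (coneCos α τ hα) n c.r ≤ Real.cosh ε := by
  rcases c.r_nonneg.eq_or_lt with h | h
  -- On the singular core `injrad` is `0` by convention; correspondingly, the rotation by `α` (index
  -- `0`) fixes the axis.
  · refine iff_of_true ?_ ⟨0, trivial, ?_⟩
    · rw [thin, Set.mem_ofPred_eq, injrad, if_pos ⟨hα'.ne, ofCyl_mem_core.2 h.symm⟩]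
      positivity
    · rw [← h, disp]
      simp
  · obtain ⟨z₀, hz₀, hne, hmin, hiff⟩ := (hasDisplacements_cutCos (τ := τ) hα hl).exists_min hl c
    rw [← hiff ε hε, thin, Set.mem_ofPred_eq, injrad_singular hα hα' hl c h hz₀ hne hmin,
      div_le_div_iff_of_pos_right two_pos]

/-- The largest of the translation radii is the tube radius. -/
theorem exists_radius {ε : ℝ} {I : Set ℕ} {κ : ℕ → ℝ} {T : ℕ → EReal} {M : EReal}
    (hthin : ∀ c : Cyl, ofCyl α l τ c ∈ thin α l τ ε ↔ ∃ n ∈ I, disp l κ n c.r ≤ Real.cosh ε)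
    (hT : ∀ n ∈ I, ∀ r : ℝ, 0 ≤ r → ((r : EReal) ≤ T n ↔ disp l κ n r ≤ Real.cosh ε))
    (htop : ∀ n ∈ I, T n ≠ ⊤) (hM : IsGreatest {x | ∃ n ∈ I, x = T n} M)
    (hne : (thin α l τ ε).Nonempty) :
    ∃ r : ℝ, (r : EReal) = M ∧ ∀ r' : ℝ, IsTubeRadius α l τ ε r' ↔ r' = r := by
  have hmem : ∀ c : Cyl, ofCyl α l τ c ∈ thin α l τ ε ↔ (c.r : EReal) ≤ M := by
    intro c
    rw [hthin]
    constructor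
    · rintro ⟨n, hn, h⟩
      exact ((hT n hn c.r c.r_nonneg).2 h).trans (hM.2 ⟨n, hn, rfl⟩)
    · intro h
      obtain ⟨n, hn, rfl⟩ := hM.1
      exact ⟨n, hn, (hT n hn c.r c.r_nonneg).1 h⟩
  obtain ⟨x, hx⟩ := hne
  obtain ⟨c, rfl⟩ := exists_ofCyl x
  have hc := (hmem c).1 hx
  have hMbot : M ≠ ⊥ := fun h => EReal.coe_ne_bot c.r (le_bot_iff.1 (h ▸ hc))
  have hMtop : M ≠ ⊤ := by
    obtain ⟨n, hn, rfl⟩ := hM.1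
    exact htop n hn
  lift M to ℝ using ⟨hMtop, hMbot⟩
  rw [EReal.coe_le_coe_iff] at hc
  refine ⟨M, rfl, isTubeRadius_iff (c.r_nonneg.trans hc) ?_⟩
  ext y
  obtain ⟨b, rfl⟩ := exists_ofCyl y
  rw [hmem, EReal.coe_le_coe_iff, Set.mem_ofPred_eq, coreDist_ofCyl]

theorem one_lt_cosh_nat_mul (hl : 0 < l) {n : ℕ} (hn : n ≠ 0) : 1 < Real.cosh (n * l) :=
  Real.one_lt_cosh.2 (mul_ne_zero (Nat.cast_ne_zero.2 hn) hl.ne')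

theorem cutCos_angleMod_two_pi (a : ℝ) :
    cutCos (angleMod a (2 * Real.pi) Real.two_pi_pos) = Real.cos a := by
  obtain ⟨m, hm⟩ := exists_angleMod_eq Real.two_pi_pos a
  rw [cutCos_of_le (by linarith [abs_angleMod_le Real.two_pi_pos a]), hm,
    Real.cos_add_int_mul_two_pi]

/-- For an angle of at least `π` the shortest path to the rotated point goes through the axis and
has length `2r`. -/
theorem trad_zero_of_pi_le {ε : ℝ} (hε : 0 ≤ ε) (h : Real.pi ≤ α) :
    trad 0 α ε = ((ε / 2 : ℝ) : EReal) := by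
  have hk : cutCos α = -1 := cutCos_of_ge (h.trans (le_abs_self α))
  rw [trad_of_le le_rfl hε (by rw [hk, Real.cosh_zero]; norm_num), hk, Real.cosh_zero]
  have h2 := Real.cosh_two_mul (ε / 2)
  rw [mul_div_cancel₀ _ two_ne_zero] at h2
  have e : (Real.cosh ε - -1) / (1 - -1) = Real.cosh (ε / 2) ^ 2 := by
    rw [h2, Real.cosh_sq]; ring
  rw [e, Real.sqrt_sq (Real.cosh_pos _).le, Real.arcosh_cosh (by positivity)]

end ModelTorus

/-! ### The tube radius as a maximum of translation radii -/

theorem proposition3p6 (α l τ ε : ℝ) (hα : 0 < α) (hα' : α ≤ 2 * Real.pi) (hl : 0 < l)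
    (hε : (ModelTorus.thin α l τ ε).Nonempty) :
    ∃ r : ℝ, (∀ r' : ℝ, ModelTorus.IsTubeRadius α l τ ε r' ↔ r' = r) ∧
      (α = 2 * Real.pi →
        IsGreatest {x : EReal | ∃ n : ℕ, 1 ≤ n ∧
          x = trad (n * l) (angleMod (n * τ) (2 * Real.pi) Real.two_pi_pos) ε} (r : EReal) ∧
        IsGreatest {x : EReal | ∃ n : ℕ, 1 ≤ n ∧
          x = arccoshBot (Real.sqrt ((Real.cosh ε - Real.cos (n * τ)) /
            (Real.cosh (n * l) - Real.cos (n * τ))))} (r : EReal)) ∧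
      (α < 2 * Real.pi →
        (∃ M : EReal,
          IsGreatest {x : EReal | ∃ n : ℕ, 1 ≤ n ∧
            x = trad (n * l) (angleMod (n * τ) α hα) ε} M ∧
          (r : EReal) = max (trad 0 α ε) M) ∧
        (Real.pi ≤ α → trad 0 α ε = ((ε / 2 : ℝ) : EReal))) := by
  have hε0 := ModelTorus.eps_nonneg hε
  have hnl : ∀ n : ℕ, 0 ≤ n * l := fun n => by positivity
  have hlt : ∀ (n : ℕ) (t : ℝ), 1 ≤ n → cutCos t < Real.cosh (n * l) := fun n t hn =>
    (angleFun_cutCos.le_one t).trans_lt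
      (ModelTorus.one_lt_cosh_nat_mul hl (Nat.one_le_iff_ne_zero.1 hn))
  have hI : ({n | 1 ≤ n} : Set ℕ).Nonempty := ⟨1, le_refl (1 : ℕ)⟩
  rcases hα'.eq_or_lt with rfl | hα'
  · obtain ⟨M, hM⟩ := exists_isGreatest_of_finite (finite_trad_ne_bot hl
      (fun n => angleMod (n * τ) (2 * Real.pi) Real.two_pi_pos) ε) hI
    obtain ⟨r, rfl, hr⟩ := ModelTorus.exists_radius (ModelTorus.mem_thin_nonsingular hl hε0)
      (fun n hn r hr => by
        rw [le_trad_iff (hnl n) hε0 (hlt n _ hn) hr, disp, ModelTorus.cutCos_angleMod_two_pi])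
      (fun n hn => trad_ne_top (hnl n) (hlt n _ hn)) hM hε
    refine ⟨r, hr, fun _ => ⟨hM, ?_⟩, fun h => absurd h (lt_irrefl _)⟩
    convert hM using 5 with x n
    refine and_congr_right fun hn => ?_
    have hc := ModelTorus.cutCos_angleMod_two_pi (n * τ)
    rw [arccoshBot_eq_trad (hnl n) hε0 hc (hc ▸ hlt n _ hn)]
  · obtain ⟨M, hM⟩ := exists_isGreatest_of_finite (finite_trad_ne_bot hl
      (fun n => angleMod (n * τ) α hα) ε) hI
    -- Index `0` carries the elliptic generator, as in `coneCos`, so the two-part maximum becomes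
    -- the greatest element of one family.
    set T : ℕ → EReal := fun n =>
      if n = 0 then trad 0 α ε else trad (n * l) (angleMod (n * τ) α hα) ε with hT
    have hT0 : T 0 = trad 0 α ε := if_pos rfl
    have hTn : ∀ n, n ≠ 0 → T n = trad (n * l) (angleMod (n * τ) α hα) ε := fun n hn => if_neg hn
    have hlt0 : cutCos α < Real.cosh 0 := by rw [Real.cosh_zero]; exact cutCos_lt_one hα.ne'
    have hmax : IsGreatest {x | ∃ n ∈ Set.univ, x = T n} (max (trad 0 α ε) M) := by
      constructor
      · rcases max_choice (trad 0 α ε) M with h | h <;> rw [h]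
        · exact ⟨0, trivial, hT0.symm⟩
        · obtain ⟨n, hn, h⟩ := hM.1
          exact ⟨n, trivial, by rw [h, hTn n (Nat.one_le_iff_ne_zero.1 hn)]⟩
      · rintro _ ⟨n, -, rfl⟩
        rcases eq_or_ne n 0 with rfl | hn
        · rw [hT0]; exact le_max_left _ _
        · rw [hTn n hn]
          exact (hM.2 ⟨n, Nat.one_le_iff_ne_zero.2 hn, rfl⟩).trans (le_max_right _ _)
    obtain ⟨r, hrM, hr⟩ := ModelTorus.exists_radius (ModelTorus.mem_thin_singular hα hα' hl hε0)
      (fun n _ r hr => by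
        rcases eq_or_ne n 0 with rfl | hn
        · rw [hT0, le_trad_iff le_rfl hε0 hlt0 hr, disp, ModelTorus.coneCos, if_pos rfl,
            Nat.cast_zero, zero_mul]
        · rw [hTn n hn, le_trad_iff (hnl n) hε0 (hlt n _ (Nat.one_le_iff_ne_zero.2 hn)) hr, disp,
            ModelTorus.coneCos, if_neg hn])
      (fun n _ => by
        rcases eq_or_ne n 0 with rfl | hn
        · rw [hT0]; exact trad_ne_top le_rfl hlt0
        · rw [hTn n hn]; exact trad_ne_top (hnl n) (hlt n _ (Nat.one_le_iff_ne_zero.2 hn)))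
      hmax hε
    exact ⟨r, hr, fun h => absurd h hα'.ne, fun _ => ⟨⟨M, hM, hrM⟩,
      ModelTorus.trad_zero_of_pi_le hε0⟩⟩
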